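/- Let $M$ be a smooth (Hausdorff, second countable, finite-dimensional) manifold without boundary and let $c$ be a closed smooth three-form on $M$. Let $G$ be a Lie group with Lie algebra $\mathfrak g$, acting smoothly on $M$ and preserving $c$, i.e. $a^*c=c$ for all $a\in G$. For $\mathsf X\in\mathfrak g$ let $X$ be the vector field on $M$ generated by $\mathsf X$. Let $$\mathcal P_{\mathfrak g}=\ker\bigl(L\colon \Lambda^2\mathfrak g\to\mathfrak g\bigr),\qquad L(\mathsf X\wedge\mathsf Y)=[\mathsf X,\mathsf Y],$$ be the Lie kernel of $\mathfrak g$; it is invariant under the action of $G$ on $\Lambda^2\mathfrak g$ induced by the adjoint action, and $G$ acts on its dual $\mathcal P_{\mathfrak g}^*$ by $\langle a\cdot\beta,\mathsf p\rangle=\langle\beta,\mathrm{Ad}_{a^{-1}}\mathsf p\rangle$. For $\mathsf p=\sum_j \mathsf X_j\wedge \mathsf Y_j\in\mathcal P_{\mathfrak g}$ write $p\lrcorner c=\sum_j c(X_j,Y_j,\cdot)$. A multi-moment map is a smooth map $\nu\colon M\to\mathcal P_{\mathfrak g}^*$ which is equivariant, $\nu(a\cdot m)=a\cdot\nu(m)$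 for all $a\in G$, $m\in M$, and satisfies $d\langle\nu,\mathsf p\rangle=p\lrcorner c$ for every $\mathsf p\in\mathcal P_{\mathfrak g}$. Suppose that $b_1(M)=\dim H^1_{\mathrm{dR}}(M)=0$. If either 1. $G$ is compact, or 2. $M$ is compact and orientable, and $G$ preserves a volume form on $M$ (a nowhere vanishing smooth form of top degree), then there exists a multi-moment map $\nu\colon M\to\mathcal P_{\mathfrak g}^*$. -/

import Mathlib

open scoped Manifold ContDiff

noncomputable section

namespace MultiMoment

/-! ### Differential forms on a smooth manifold modelled on `E` -/

section Forms

variable (E : Type*) [NormedAddCommGroup E] [NormedSpace ℝ E]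
  (M : Type*) [TopologicalSpace M] [ChartedSpace E M]

/-- A (not necessarily continuous) field of alternating `k`-linear forms on the tangent spaces. -/
abbrev FormField (k : ℕ) : Type _ :=
  (x : M) → (TangentSpace 𝓘(ℝ, E) x) [⋀^Fin k]→L[ℝ] ℝ

variable {E M}

/-- The expression of `α` in the preferred chart at `x₀`: the pullback of `α` under the inverse of
that chart. It is meaningful on the target of the chart, an open subset of `E`. -/
def formInChart {k : ℕ} (α : FormField E M k) (x₀ : M) (y : E) : E [⋀^Fin k]→L[ℝ] ℝ :=
  (α ((extChartAt 𝓘(ℝ, E) x₀).symm y)).compContinuousLinearMap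
    (mfderiv 𝓘(ℝ, E) 𝓘(ℝ, E) (extChartAt 𝓘(ℝ, E) x₀).symm y)

/-- A form is smooth if its expressions in charts are smooth. -/
def IsSmoothForm {k : ℕ} (α : FormField E M k) : Prop :=
  ∀ x₀ : M, ContDiffOn ℝ ∞ (formInChart α x₀) (extChartAt 𝓘(ℝ, E) x₀).target

/-- The exterior derivative: at `x`, differentiate the expression of `α` in the preferred chart
at `x`, and pull the result back to `T_x M` by the differential of the chart. -/
def mextDeriv {k : ℕ} (α : FormField E M k) : FormField E M (k + 1) := fun x =>
  (extDeriv (formInChart α x) (extChartAt 𝓘(ℝ, E) x x)).compContinuousLinearMap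
    (mfderiv 𝓘(ℝ, E) 𝓘(ℝ, E) (extChartAt 𝓘(ℝ, E) x) x)

/-- The pullback `f^* α` of a form along a self-map. -/
def pullbackForm {k : ℕ} (f : M → M) (α : FormField E M k) : FormField E M k := fun x =>
  (α (f x)).compContinuousLinearMap (mfderiv 𝓘(ℝ, E) 𝓘(ℝ, E) f x)

/-- The differential `df` of a real function, as a one-form. -/
def differential (f : M → ℝ) : FormField E M 1 := fun x =>
  ContinuousAlternatingMap.ofSubsingleton ℝ (TangentSpace 𝓘(ℝ, E) x) ℝ (0 : Fin 1)
    (mfderiv 𝓘(ℝ, E) 𝓘(ℝ, ℝ) f x)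

theorem formInChart_zero {k : ℕ} (x₀ : M) :
    formInChart (0 : FormField E M k) x₀ = 0 := rfl

theorem formInChart_add {k : ℕ} (α η : FormField E M k) (x₀ : M) :
    formInChart (α + η) x₀ = formInChart α x₀ + formInChart η x₀ := rfl

theorem formInChart_smul {k : ℕ} (a : ℝ) (α : FormField E M k) (x₀ : M) :
    formInChart (a • α) x₀ = a • formInChart α x₀ := rfl

theorem IsSmoothForm.differentiableAt {k : ℕ} {α : FormField E M k} (h : IsSmoothForm α) (x : M) :
    DifferentiableAt ℝ (formInChart α x) (extChartAt 𝓘(ℝ, E) x x) :=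
  ((h x).contDiffAt (extChartAt_target_mem_nhds (I := 𝓘(ℝ, E)) x)).differentiableAt (by simp)

theorem mextDeriv_zero {k : ℕ} : mextDeriv (0 : FormField E M k) = 0 := by
  funext x
  have h : extDeriv (0 : E → E [⋀^Fin k]→L[ℝ] ℝ) (extChartAt 𝓘(ℝ, E) x x) = 0 := by
    have := extDeriv_smul (0 : ℝ) (0 : E → E [⋀^Fin k]→L[ℝ] ℝ) (x := extChartAt 𝓘(ℝ, E) x x)
    simpa using this
  unfold mextDeriv
  rw [formInChart_zero, h]
  rfl

theorem mextDeriv_add {k : ℕ} {α η : FormField E M k} (hα : IsSmoothForm α)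
    (hη : IsSmoothForm η) : mextDeriv (α + η) = mextDeriv α + mextDeriv η := by
  funext x
  unfold mextDeriv
  rw [formInChart_add, extDeriv_add (hα.differentiableAt x) (hη.differentiableAt x)]
  rfl

theorem mextDeriv_smul {k : ℕ} (a : ℝ) (α : FormField E M k) :
    mextDeriv (a • α) = a • mextDeriv α := by
  funext x
  unfold mextDeriv
  rw [formInChart_smul, extDeriv_smul]
  rfl

variable (E M) in
/-- The space of smooth closed `k`-forms on `M`. -/
def closedForms (k : ℕ) : Submodule ℝ (FormField E M k) where
  carrier := {α | IsSmoothForm α ∧ mextDeriv α = 0}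
  zero_mem' := ⟨fun x₀ => by rw [formInChart_zero]; exact contDiffOn_const, mextDeriv_zero⟩
  add_mem' := by
    rintro α η ⟨hα, hα'⟩ ⟨hη, hη'⟩
    refine ⟨fun x₀ => ?_, ?_⟩
    · rw [formInChart_add]; exact (hα x₀).add (hη x₀)
    · rw [mextDeriv_add hα hη, hα', hη', add_zero]
  smul_mem' := by
    rintro a α ⟨hα, hα'⟩
    refine ⟨fun x₀ => ?_, ?_⟩
    · rw [formInChart_smul]; exact contDiffOn_const.smul (hα x₀)
    · rw [mextDeriv_smul, hα', smul_zero]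

variable (E M) in
/-- The space of exact one-forms: the differentials of smooth functions. -/
def exactOneForms : Submodule ℝ (FormField E M 1) where
  carrier := {α | ∃ f : M → ℝ, ContMDiff 𝓘(ℝ, E) 𝓘(ℝ, ℝ) ∞ f ∧ α = differential f}
  zero_mem' := by
    refine ⟨fun _ => 0, contMDiff_const, ?_⟩
    funext x
    unfold differential
    rw [mfderiv_const]
    ext v
    rfl
  add_mem' := by
    rintro _ _ ⟨f, hf, rfl⟩ ⟨g, hg, rfl⟩
    refine ⟨f + g, hf.add hg, ?_⟩
    funext x
    unfold differential
    rw [mfderiv_add (hf.mdifferentiableAt (by simp)) (hg.mdifferentiableAt (by simp))]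
    ext v
    rfl
  smul_mem' := by
    rintro a _ ⟨f, hf, rfl⟩
    refine ⟨fun x => a * f x, contMDiff_const.mul hf, ?_⟩
    funext x
    have h : mfderiv 𝓘(ℝ, E) 𝓘(ℝ, ℝ) (fun y => a * f y) x
        = a • mfderiv 𝓘(ℝ, E) 𝓘(ℝ, ℝ) f x :=
      const_smul_mfderiv (hf.mdifferentiableAt (by simp)) a
    change a • _ = ContinuousAlternatingMap.ofSubsingleton ℝ _ ℝ (0 : Fin 1) _
    rw [h]
    rfl

instance (k : ℕ) : AddCommGroup (closedForms E M k) := Submodule.addCommGroup _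

variable (E M) in
/-- The first de Rham cohomology `H¹(M)`: closed one-forms modulo exact one-forms. -/
abbrev DeRhamH1 : Type _ :=
  closedForms E M 1 ⧸ (exactOneForms E M).submoduleOf (closedForms E M 1)

variable (E M) in
/-- The first Betti number `b₁(M) = dim H¹(M)`. -/
def firstBetti : Cardinal := Module.rank ℝ (DeRhamH1 E M)

end Forms

/-! ### The Lie kernel and the adjoint action -/

section LieKernel

variable (g : Type*) [LieRing g] [LieAlgebra ℝ g]

/-- The Lie bracket as an alternating bilinear map. -/
def bracketAlternating : g [⋀^Fin 2]→ₗ[ℝ] g where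
  toFun X := ⁅X 0, X 1⁆
  map_update_add' X i x y := by fin_cases i <;> simp
  map_update_smul' X i a x := by fin_cases i <;> simp
  map_eq_zero_of_eq' X i j h hij := by
    have h01 : X 0 = X 1 := by fin_cases i <;> fin_cases j <;> simp_all
    simp [h01]

/-- The linear map `L : Λ² g → g`, `X ∧ Y ↦ [X, Y]`, induced by the Lie bracket. -/
def bracketMap : ⋀[ℝ]^2 g →ₗ[ℝ] g :=
  exteriorPower.alternatingMapLinearEquiv (bracketAlternating g)

/-- The Lie kernel of a Lie algebra: the kernel of `L : Λ² g → g`. -/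
def lieKernel : Submodule ℝ (⋀[ℝ]^2 g) := LinearMap.ker (bracketMap g)

variable {g}

/-- A Lie algebra endomorphism `φ` induces an endomorphism of `Λ² g` that preserves
the Lie kernel. -/
theorem map_mem_lieKernel (φ : g →ₗ[ℝ] g) (hφ : ∀ X Y : g, φ ⁅X, Y⁆ = ⁅φ X, φ Y⁆)
    (p : ⋀[ℝ]^2 g) (hp : p ∈ lieKernel g) : exteriorPower.map 2 φ p ∈ lieKernel g := by
  have h : (bracketMap g) ∘ₗ exteriorPower.map 2 φ = φ ∘ₗ bracketMap g := by
    apply exteriorPower.linearMap_ext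
    ext X
    simp [bracketMap, bracketAlternating, hφ]
  have h' := LinearMap.congr_fun h p
  simp only [LinearMap.comp_apply] at h'
  rw [lieKernel, LinearMap.mem_ker] at hp ⊢
  rw [h', hp, map_zero]

end LieKernel

section Adjoint

theorem mfderiv_apply_congr (F : Type*) [NormedAddCommGroup F] [NormedSpace ℝ F]
    {G : Type*} [TopologicalSpace G] [ChartedSpace F G] {f g : G → G} (hfg : f = g) {y z : G} (h : y = z) (v : F) :
    (mfderiv 𝓘(ℝ, F) 𝓘(ℝ, F) f y : F →L[ℝ] F) v =
      (mfderiv 𝓘(ℝ, F) 𝓘(ℝ, F) g z : F →L[ℝ] F) v := by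
  subst h hfg; rfl

variable {F : Type*} [NormedAddCommGroup F] [NormedSpace ℝ F]
  {G : Type*} [TopologicalSpace G] [ChartedSpace F G] [Group G]

variable (F) in
/-- The adjoint action `Ad_a : g → g`: the derivative at the identity of `h ↦ a h a⁻¹`. -/
def Ad (a : G) : GroupLieAlgebra 𝓘(ℝ, F) G →ₗ[ℝ] GroupLieAlgebra 𝓘(ℝ, F) G :=
  let A : TangentSpace 𝓘(ℝ, F) (1 : G) →L[ℝ] TangentSpace 𝓘(ℝ, F) (1 : G) :=
    mfderiv 𝓘(ℝ, F) 𝓘(ℝ, F) (fun h : G => a * h * a⁻¹) 1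
  A.toLinearMap

variable [LieGroup 𝓘(ℝ, F) ∞ G]

instance instLieGroupMinSmoothness : LieGroup 𝓘(ℝ, F) (minSmoothness ℝ 3) G :=
  LieGroup.of_le (n := ∞) (by
    rw [minSmoothness_of_isRCLikeNormedField]
    exact ENat.LEInfty.out)

theorem contMDiff_conj (a : G) :
    ContMDiff 𝓘(ℝ, F) 𝓘(ℝ, F) ∞ (fun h : G => a * h * a⁻¹) :=
  (contMDiff_mul_right (a := a⁻¹)).comp (contMDiff_mul_left (a := a))

theorem mdifferentiableAt_conj (a x : G) :
    MDifferentiableAt 𝓘(ℝ, F) 𝓘(ℝ, F) (fun h : G => a * h * a⁻¹) x :=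
  (contMDiff_conj a).mdifferentiableAt (by simp)

theorem mdifferentiableAt_mul_left' (a x : G) :
    MDifferentiableAt 𝓘(ℝ, F) 𝓘(ℝ, F) (fun h : G => a * h) x :=
  (contMDiff_mul_left (n := ∞) (a := a)).mdifferentiableAt (by simp)

theorem isInvertible_mfderiv_conj (a h : G) :
    (mfderiv 𝓘(ℝ, F) 𝓘(ℝ, F) (fun x : G => a * x * a⁻¹) h).IsInvertible := by
  apply ContinuousLinearMap.IsInvertible.of_inverse
    (g := mfderiv 𝓘(ℝ, F) 𝓘(ℝ, F) (fun x : G => a⁻¹ * x * a⁻¹⁻¹) (a * h * a⁻¹))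
  · ext v
    have e := mfderiv_comp (I := 𝓘(ℝ, F)) (I' := 𝓘(ℝ, F)) (I'' := 𝓘(ℝ, F)) (a * h * a⁻¹)
      (mdifferentiableAt_conj (F := F) a (a⁻¹ * (a * h * a⁻¹) * a⁻¹⁻¹))
      (mdifferentiableAt_conj (F := F) a⁻¹ (a * h * a⁻¹))
    have e' := DFunLike.congr_fun e v
    have hid : (fun x : G => a * x * a⁻¹) ∘ (fun x : G => a⁻¹ * x * a⁻¹⁻¹) = id := by
      funext x; simp [mul_assoc]
    have e2 := mfderiv_apply_congr F hid (rfl : a * h * a⁻¹ = _) v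
    have e3 := mfderiv_apply_congr F (rfl : (fun x : G => a * x * a⁻¹) = _)
      (show a⁻¹ * (a * h * a⁻¹) * a⁻¹⁻¹ = h by simp [mul_assoc])
      (mfderiv 𝓘(ℝ, F) 𝓘(ℝ, F) (fun x : G => a⁻¹ * x * a⁻¹⁻¹) (a * h * a⁻¹) v)
    rw [mfderiv_id] at e2
    exact (e3.symm.trans e'.symm).trans e2
  · ext v
    have e := mfderiv_comp (I := 𝓘(ℝ, F)) (I' := 𝓘(ℝ, F)) (I'' := 𝓘(ℝ, F)) h
      (mdifferentiableAt_conj (F := F) a⁻¹ (a * h * a⁻¹)) (mdifferentiableAt_conj (F := F) a h)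
    have e' := DFunLike.congr_fun e v
    have hid : (fun x : G => a⁻¹ * x * a⁻¹⁻¹) ∘ (fun x : G => a * x * a⁻¹) = id := by
      funext x; simp [mul_assoc]
    have e2 := mfderiv_apply_congr F hid (rfl : h = _) v
    rw [mfderiv_id] at e2
    exact e'.symm.trans e2

/-- Conjugation maps left-invariant fields to left-invariant fields. -/
theorem mfderiv_conj_mulInvariantVectorField (a h : G) (X : GroupLieAlgebra 𝓘(ℝ, F) G) :
    mfderiv 𝓘(ℝ, F) 𝓘(ℝ, F) (fun h : G => a * h * a⁻¹) h (mulInvariantVectorField X h) =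
      mulInvariantVectorField (I := 𝓘(ℝ, F)) (Ad F a X) (a * h * a⁻¹) := by
  have e : (fun x : G => a * x * a⁻¹) ∘ (fun x : G => h * x) =
      (fun x : G => (a * h * a⁻¹) * x) ∘ (fun x : G => a * x * a⁻¹) := by
    funext x; simp [mul_assoc]
  have e1 := DFunLike.congr_fun
    (mfderiv_comp (I := 𝓘(ℝ, F)) (I' := 𝓘(ℝ, F)) (I'' := 𝓘(ℝ, F)) (1 : G)
      (mdifferentiableAt_conj (F := F) a (h * 1)) (mdifferentiableAt_mul_left' (F := F) h 1)) X
  have e2 := DFunLike.congr_fun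
    (mfderiv_comp (I := 𝓘(ℝ, F)) (I' := 𝓘(ℝ, F)) (I'' := 𝓘(ℝ, F)) (1 : G)
      (mdifferentiableAt_mul_left' (F := F) (a * h * a⁻¹) (a * 1 * a⁻¹))
      (mdifferentiableAt_conj (F := F) a 1)) X
  have e3 := mfderiv_apply_congr F e (rfl : (1 : G) = 1) X
  have e4 := mfderiv_apply_congr F (rfl : (fun x : G => a * x * a⁻¹) = _) (mul_one h)
    (mulInvariantVectorField X h : TangentSpace 𝓘(ℝ, F) h)
  have e5 := mfderiv_apply_congr F (rfl : (fun x : G => (a * h * a⁻¹) * x) = _)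
    (show a * 1 * a⁻¹ = 1 by simp) (Ad F a X)
  exact ((e4.symm.trans e1.symm).trans (e3.trans e2)).trans e5

open VectorField in
/-- `Ad_a` is an endomorphism of the Lie algebra. -/
theorem Ad_lie [FiniteDimensional ℝ F] (a : G) (X Y : GroupLieAlgebra 𝓘(ℝ, F) G) :
    Ad F a ⁅X, Y⁆ = ⁅Ad F a X, Ad F a Y⁆ := by
  have hpull : ∀ Z : GroupLieAlgebra 𝓘(ℝ, F) G,
      mpullback 𝓘(ℝ, F) 𝓘(ℝ, F) (fun h : G => a * h * a⁻¹)
        (mulInvariantVectorField (I := 𝓘(ℝ, F)) (Ad F a Z)) = mulInvariantVectorField Z := by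
    intro Z
    funext h
    rw [mpullback_apply, (isInvertible_mfderiv_conj a h).inverse_apply_eq]
    exact (mfderiv_conj_mulInvariantVectorField a h Z).symm
  have hm := mpullback_mlieBracket (I := 𝓘(ℝ, F)) (I' := 𝓘(ℝ, F)) (n := ∞) (x₀ := (1 : G))
    (f := fun h : G => a * h * a⁻¹)
    (mdifferentiableAt_mulInvariantVectorField (Ad F a X))
    (mdifferentiableAt_mulInvariantVectorField (Ad F a Y))
    (contMDiff_conj a).contMDiffAt
    (by rw [minSmoothness_of_isRCLikeNormedField]; exact ENat.LEInfty.out)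
  rw [hpull, hpull, mpullback_apply, (isInvertible_mfderiv_conj a 1).inverse_apply_eq] at hm
  have h1 : ∀ y : G, y = 1 → (mlieBracket 𝓘(ℝ, F)
      (mulInvariantVectorField (I := 𝓘(ℝ, F)) (Ad F a X))
      (mulInvariantVectorField (I := 𝓘(ℝ, F)) (Ad F a Y)) y : F) =
      (⁅Ad F a X, Ad F a Y⁆ : GroupLieAlgebra 𝓘(ℝ, F) G) := by
    rintro _ rfl; rfl
  exact hm.symm.trans (h1 _ (by simp))

variable (F) in
/-- The action of `a ∈ G` on the Lie kernel induced by the adjoint action. -/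
def AdLieKernel [FiniteDimensional ℝ F] (a : G) :
    lieKernel (GroupLieAlgebra 𝓘(ℝ, F) G) →ₗ[ℝ] lieKernel (GroupLieAlgebra 𝓘(ℝ, F) G) :=
  (exteriorPower.map 2 (Ad F a)).restrict (fun p hp => map_mem_lieKernel _ (Ad_lie a) p hp)

end Adjoint

/-! ### Multi-moment maps -/

section MultiMomentMap

/-- The contraction `q ↦ q ⌟ ω` of bivectors with a three-form, evaluated on a vector `v`: the
linear functional on `Λ² V` with `X ∧ Y ↦ ω(X, Y, v)`. -/
def contractBivector {V : Type*} [AddCommGroup V] [Module ℝ V] [TopologicalSpace V]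
    (γ : V [⋀^Fin 3]→L[ℝ] ℝ) (v : V) : ⋀[ℝ]^2 V →ₗ[ℝ] ℝ :=
  exteriorPower.alternatingMapLinearEquiv
    { toFun := fun X => γ ![X 0, X 1, v]
      map_update_add' := by
        intro _ X i x y
        fin_cases i
        · have hu (z : V) : Function.update ![X 0, X 1, v] 0 z = ![z, X 1, v] := by
            ext j; fin_cases j <;> rfl
          have h := γ.map_update_add ![X 0, X 1, v] 0 x y
          rw [hu, hu, hu] at h
          simpa using h
        · have hu (z : V) : Function.update ![X 0, X 1, v] 1 z = ![X 0, z, v] := by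
            ext j; fin_cases j <;> rfl
          have h := γ.map_update_add ![X 0, X 1, v] 1 x y
          rw [hu, hu, hu] at h
          simpa using h
      map_update_smul' := by
        intro _ X i a x
        fin_cases i
        · have hu (z : V) : Function.update ![X 0, X 1, v] 0 z = ![z, X 1, v] := by
            ext j; fin_cases j <;> rfl
          have h := γ.map_update_smul ![X 0, X 1, v] 0 a x
          rw [hu, hu] at h
          simpa using h
        · have hu (z : V) : Function.update ![X 0, X 1, v] 1 z = ![X 0, z, v] := by
            ext j; fin_cases j <;> rfl
          have h := γ.map_update_smul ![X 0, X 1, v] 1 a x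
          rw [hu, hu] at h
          simpa using h
      map_eq_zero_of_eq' := by
        intro X i j h hij
        have h01 : X 0 = X 1 := by fin_cases i <;> fin_cases j <;> simp_all
        exact γ.map_eq_zero_of_eq _ (i := 0) (j := 1) (by simpa using h01) (by decide) }

variable {E : Type*} [NormedAddCommGroup E] [NormedSpace ℝ E]
  {F : Type*} [NormedAddCommGroup F] [NormedSpace ℝ F]
  {M : Type*} [TopologicalSpace M] [ChartedSpace E M]
  {G : Type*} [TopologicalSpace G] [ChartedSpace F G] [Group G] [MulAction G M]

variable (E F G) in
/-- The infinitesimal action at `m`: it sends `X ∈ g` to the value at `m` of the vector field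
on `M` generated by `X`, i.e. to the derivative at `a = 1` of `a ↦ a • m` in the direction `X`. -/
def infinitesimalAction (m : M) : GroupLieAlgebra 𝓘(ℝ, F) G →ₗ[ℝ] TangentSpace 𝓘(ℝ, E) m :=
  let A : TangentSpace 𝓘(ℝ, F) (1 : G) →L[ℝ] TangentSpace 𝓘(ℝ, E) m :=
    mfderiv 𝓘(ℝ, F) 𝓘(ℝ, E) (fun a : G => a • m) 1
  A.toLinearMap

variable (E F G) in
/-- The value at `m` of the bivector field `∑ Xⱼ ∧ Yⱼ` on `M` generated by an element
`∑ Xⱼ ∧ Yⱼ` of `Λ² g`. -/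
def generatedBivector (m : M) :
    ⋀[ℝ]^2 (GroupLieAlgebra 𝓘(ℝ, F) G) →ₗ[ℝ] ⋀[ℝ]^2 (TangentSpace 𝓘(ℝ, E) m) :=
  exteriorPower.map 2 (infinitesimalAction E F G m)

variable (G) in
/-- The form `α` is preserved by the action of `G`: `a^* α = α` for all `a ∈ G`. -/
def IsInvariantForm {k : ℕ} (α : FormField E M k) : Prop :=
  ∀ a : G, pullbackForm (fun m : M => a • m) α = α

/-- A volume form: a smooth form of top degree that vanishes nowhere. -/
def IsVolumeForm (μ : FormField E M (Module.finrank ℝ E)) : Prop :=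
  IsSmoothForm μ ∧ ∀ m : M, μ m ≠ 0

variable [FiniteDimensional ℝ F] [LieGroup 𝓘(ℝ, F) ∞ G]

variable (F) in
/-- The action of `a ∈ G` on the dual of the Lie kernel, contragredient to the one induced by the
adjoint action: `⟨a · β, p⟩ = ⟨β, Ad_{a⁻¹} p⟩`. -/
def coAdLieKernel (a : G) (β : Module.Dual ℝ (lieKernel (GroupLieAlgebra 𝓘(ℝ, F) G))) :
    Module.Dual ℝ (lieKernel (GroupLieAlgebra 𝓘(ℝ, F) G)) :=
  β ∘ₗ AdLieKernel F a⁻¹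

/-- A multi-moment map for the action of `G` on `(M, c)`: a smooth equivariant map `ν` from `M` to
the dual of the Lie kernel with `d⟨ν, p⟩ = p ⌟ c` for each `p` in the Lie kernel. Since the
Lie kernel is finite-dimensional, smoothness of `ν` is smoothness of all functions `⟨ν, p⟩`. -/
structure IsMultiMomentMap (c : FormField E M 3)
    (ν : M → Module.Dual ℝ (lieKernel (GroupLieAlgebra 𝓘(ℝ, F) G))) : Prop where
  smooth : ∀ p : lieKernel (GroupLieAlgebra 𝓘(ℝ, F) G),
    ContMDiff 𝓘(ℝ, E) 𝓘(ℝ, ℝ) ∞ (fun m => ν m p)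
  differential_eq : ∀ (p : lieKernel (GroupLieAlgebra 𝓘(ℝ, F) G)) (m : M)
    (v : TangentSpace 𝓘(ℝ, E) m),
    mfderiv 𝓘(ℝ, E) 𝓘(ℝ, ℝ) (fun m => ν m p) m v =
      contractBivector (c m) v (generatedBivector E F G m p)
  equivariant : ∀ (a : G) (m : M), ν (a • m) = coAdLieKernel F a (ν m)

end MultiMomentMap

end MultiMoment

end

/-!
For `p` in the Lie kernel, the one-form `p ⌟ c` is smooth and closed. Indeed, for a closed invariant
three-form `c` and any `p ∈ Λ²g`, Cartan calculus gives `d(p ⌟ c) = -c(·, L(p), ·)`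
(`contractionForm_smooth_and_mextDeriv`). By linearity this is a statement about `p = X ∧ Y`, and it
is checked in a chart: `extDeriv_contraction` is the computation with closed forms and vector
fields preserving them, `lieDeriv₃_eq_zero` deduces from invariance that the Lie derivatives along
generated fields vanish, and `lieBracket_fundamentalFieldInChart` says that the bracket of the fields
generated by `X` and `Y` is minus the field generated by `[X, Y]`.

As `b₁(M) = 0`, integrating these forms for `p` in a basis of the Lie kernel gives a smooth map `ν₀`
into its dual with `d⟨ν₀, p⟩ = p ⌟ c` (`exists_primitive`). For each `a ∈ G` the maps `m ↦ ν₀(a m)`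
and `m ↦ a · ν₀(m)` have the same differential, so on every connected component their difference is
constant (`equivariance_defect_const`): `ν₀` intertwines the action of `a` with an affine map.

It remains to subtract from `ν₀` a locally constant map `ζ` that makes it equivariant. Let `K_m` be
a nonempty compact subset of the connected component of `m`, depending only on that component, with
`K_{a m} = a K_m` (`exists_equivariant_compact`): the whole component if `M` is compact, and its
intersection with an orbit, the same for all translates of the component, if `G` is compact. Set
`ζ(m)` to be the centroid of `ν₀(K_m)`. Centroids of compact sets commute with affine
automorphisms (`centroid_image`), so `ζ` transforms under `G` exactly as `ν₀` does, and `ν₀ - ζ` is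
a multi-moment map. The centroid replaces the average over `G` or over `M`.
-/

open scoped Manifold ContDiff

noncomputable section

namespace MultiMoment

open Topology

/-! ### The contraction of a closed invariant three-form in coordinates -/

section Coordinates

variable {E : Type*} [NormedAddCommGroup E] [NormedSpace ℝ E]

theorem threeForm_swap₀₁ (γ : E [⋀^Fin 3]→L[ℝ] ℝ) (a b c : E) :
    γ ![b, a, c] = - γ ![a, b, c] := by
  have h := γ.toAlternatingMap.map_swap ![a, b, c] (i := 0) (j := 1) (by decide)
  have e : (![a, b, c] : Fin 3 → E) ∘ Equiv.swap (0 : Fin 3) 1 = ![b, a, c] := by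
    ext i; fin_cases i <;> rfl
  rw [e] at h
  exact h

theorem threeForm_swap₁₂ (γ : E [⋀^Fin 3]→L[ℝ] ℝ) (a b c : E) :
    γ ![a, c, b] = - γ ![a, b, c] := by
  have h := γ.toAlternatingMap.map_swap ![a, b, c] (i := 1) (j := 2) (by decide)
  have e : (![a, b, c] : Fin 3 → E) ∘ Equiv.swap (1 : Fin 3) 2 = ![a, c, b] := by
    ext i; fin_cases i <;> rfl
  rw [e] at h
  exact h

theorem threeForm_add₁ (γ : E [⋀^Fin 3]→L[ℝ] ℝ) (a b b' c : E) :
    γ ![a, b + b', c] = γ ![a, b, c] + γ ![a, b', c] := by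
  have hu (z : E) : Function.update ![a, b, c] 1 z = ![a, z, c] := by
    ext j; fin_cases j <;> rfl
  have h := γ.map_update_add ![a, b, c] 1 b b'
  rwa [hu, hu, hu] at h

theorem threeForm_smul₁ (γ : E [⋀^Fin 3]→L[ℝ] ℝ) (a b c : E) (r : ℝ) :
    γ ![a, r • b, c] = r * γ ![a, b, c] := by
  have hu (z : E) : Function.update ![a, b, c] 1 z = ![a, z, c] := by
    ext j; fin_cases j <;> rfl
  have h := γ.map_update_smul ![a, b, c] 1 r b
  rwa [hu, hu] at h

/-- The product rule for a three-form evaluated on three vector fields. -/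
theorem hasFDerivAt_threeForm_apply {B : Type*} [NormedAddCommGroup B] [NormedSpace ℝ B]
    {η : B → E [⋀^Fin 3]→L[ℝ] ℝ} {X Y Z : B → E}
    {η' : B →L[ℝ] E [⋀^Fin 3]→L[ℝ] ℝ} {X' Y' Z' : B →L[ℝ] E} {b : B}
    (hη : HasFDerivAt η η' b) (hX : HasFDerivAt X X' b) (hY : HasFDerivAt Y Y' b)
    (hZ : HasFDerivAt Z Z' b) :
    ∃ L : B →L[ℝ] ℝ, HasFDerivAt (fun z => η z ![X z, Y z, Z z]) L b ∧
      ∀ u, L u = η' u ![X b, Y b, Z b] + η b ![X' u, Y b, Z b] + η b ![X b, Y' u, Z b]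
        + η b ![X b, Y b, Z' u] := by
  have hg : ∀ i : Fin 3, HasFDerivAt ((![X, Y, Z] : Fin 3 → B → E) i)
      ((![X', Y', Z'] : Fin 3 → B →L[ℝ] E) i) b := by
    intro i; fin_cases i
    exacts [hX, hY, hZ]
  have h := hη.continuousAlternatingMap_apply hg
  have e : ∀ z, (fun i => (![X, Y, Z] : Fin 3 → B → E) i z) = ![X z, Y z, Z z] := by
    intro z; ext i; fin_cases i <;> rfl
  simp only [e] at h
  refine ⟨_, h, fun u => ?_⟩
  have t0 (w : E) : η b (Function.update ![X b, Y b, Z b] 0 w) = η b ![w, Y b, Z b] := by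
    congr 1; ext j; fin_cases j <;> rfl
  have t1 (w : E) : η b (Function.update ![X b, Y b, Z b] 1 w) = η b ![X b, w, Z b] := by
    congr 1; ext j; fin_cases j <;> rfl
  have t2 (w : E) : η b (Function.update ![X b, Y b, Z b] 2 w) = η b ![X b, Y b, w] := by
    congr 1; ext j; fin_cases j <;> rfl
  rw [add_apply, sum_apply, Fin.sum_univ_three,
    ← t0, ← t1, ← t2]
  simp only [add_assoc]
  rfl

/-- The Lie derivative of the three-form `η` along `X` at `y`, evaluated on `u, v, w`. -/
def lieDeriv₃ (η : E → E [⋀^Fin 3]→L[ℝ] ℝ) (X : E → E) (y u v w : E) : ℝ :=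
  fderiv ℝ η y (X y) ![u, v, w] + η y ![fderiv ℝ X y u, v, w] + η y ![u, fderiv ℝ X y v, w]
    + η y ![u, v, fderiv ℝ X y w]

theorem extDeriv_one_apply {α : E → E [⋀^Fin 1]→L[ℝ] ℝ} {y : E} (h : DifferentiableAt ℝ α y)
    (u v : E) : extDeriv α y ![u, v] =
      fderiv ℝ (fun z => α z ![v]) y u - fderiv ℝ (fun z => α z ![u]) y v := by
  rw [extDeriv_apply h]
  have r0 : Fin.removeNth (0 : Fin 2) ![u, v] = ![v] := by ext i; fin_cases i; rfl
  have r1 : Fin.removeNth (1 : Fin 2) ![u, v] = ![u] := by ext i; fin_cases i; rfl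
  rw [Fin.sum_univ_two, r0, r1]
  simp [sub_eq_add_neg]

theorem extDeriv_three_apply {η : E → E [⋀^Fin 3]→L[ℝ] ℝ} {y : E} (a b c d : E) :
    extDeriv η y ![a, b, c, d] =
      fderiv ℝ η y a ![b, c, d] - fderiv ℝ η y b ![a, c, d] + fderiv ℝ η y c ![a, b, d]
        - fderiv ℝ η y d ![a, b, c] := by
  unfold extDeriv
  rw [ContinuousAlternatingMap.alternatizeUncurryFin_apply]
  have r0 : Fin.removeNth (0 : Fin 4) ![a, b, c, d] = ![b, c, d] := by
    ext i; fin_cases i <;> rfl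
  have r1 : Fin.removeNth (1 : Fin 4) ![a, b, c, d] = ![a, c, d] := by
    ext i; fin_cases i <;> rfl
  have r2 : Fin.removeNth (2 : Fin 4) ![a, b, c, d] = ![a, b, d] := by
    ext i; fin_cases i <;> rfl
  have r3 : Fin.removeNth (3 : Fin 4) ![a, b, c, d] = ![a, b, c] := by
    ext i; fin_cases i <;> rfl
  rw [Fin.sum_univ_four, r0, r1, r2, r3]
  simp [sub_eq_add_neg, pow_succ]

/-- If `η` is a three-form, closed at `y` and preserved to first order at `y` by `X` and `Y`, then
`d(η(X, Y, ·)) = η(·, [X, Y], ·)` at `y`. -/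
theorem extDeriv_contraction {η : E → E [⋀^Fin 3]→L[ℝ] ℝ} {X Y : E → E}
    {α : E → E [⋀^Fin 1]→L[ℝ] ℝ} {y : E}
    (hη : DifferentiableAt ℝ η y) (hX : DifferentiableAt ℝ X y) (hY : DifferentiableAt ℝ Y y)
    (hα : DifferentiableAt ℝ α y) (hαη : ∀ v, ∀ᶠ z in 𝓝 y, α z ![v] = η z ![X z, Y z, v])
    (hclosed : extDeriv η y = 0)
    (hLX : ∀ u v w, lieDeriv₃ η X y u v w = 0) (hLY : ∀ u v w, lieDeriv₃ η Y y u v w = 0)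
    (u v : E) :
    extDeriv α y ![u, v] = η y ![u, fderiv ℝ Y y (X y) - fderiv ℝ X y (Y y), v] := by
  -- The claim is the sum of `dη(u, X, Y, v) = 0`, `(L_X η)(u, Y, v) = 0` and `(L_Y η)(u, X, v) = 0`,
  -- with signs, once both sides are expanded by the product rule.
  have key : ∀ u v, fderiv ℝ (fun z => α z ![v]) y u =
      fderiv ℝ η y u ![X y, Y y, v] + η y ![fderiv ℝ X y u, Y y, v]
        + η y ![X y, fderiv ℝ Y y u, v] := by
    intro u v
    obtain ⟨L, hL, hLu⟩ := hasFDerivAt_threeForm_apply hη.hasFDerivAt hX.hasFDerivAt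
      hY.hasFDerivAt (hasFDerivAt_const v y)
    rw [Filter.EventuallyEq.fderiv_eq (hαη v), hL.fderiv, hLu]
    have : η y ![X y, Y y, (0 : E →L[ℝ] E) u] = 0 :=
      (η y).map_coord_zero (m := ![X y, Y y, (0 : E →L[ℝ] E) u]) 2 rfl
    rw [this, add_zero]
  rw [extDeriv_one_apply hα, key, key]
  have hd := extDeriv_three_apply (η := η) (y := y) u (X y) (Y y) v
  rw [hclosed] at hd
  have h1 := hLX u (Y y) v
  have h2 := hLY u (X y) v
  have hsub : η y ![u, fderiv ℝ Y y (X y) - fderiv ℝ X y (Y y), v] =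
      η y ![u, fderiv ℝ Y y (X y), v] - η y ![u, fderiv ℝ X y (Y y), v] := by
    have h := threeForm_add₁ (η y) u (fderiv ℝ Y y (X y) - fderiv ℝ X y (Y y))
      (fderiv ℝ X y (Y y)) v
    rw [sub_add_cancel] at h
    rw [h]; ring
  simp only [lieDeriv₃] at h1 h2
  rw [hsub]
  have s01 := threeForm_swap₀₁ (E := E)
  have s12 := threeForm_swap₁₂ (E := E)
  have a1 : fderiv ℝ η y v ![X y, Y y, u] = fderiv ℝ η y v ![u, X y, Y y] := by
    rw [s12 _ (X y) u (Y y), s01 _ u (X y), neg_neg]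
  have a2 : η y ![fderiv ℝ X y v, Y y, u] = - η y ![u, Y y, fderiv ℝ X y v] := by
    rw [s01 _ (Y y) _, s12 _ (Y y) u, s01 _ u (Y y)]; ring
  have a3 : η y ![X y, fderiv ℝ Y y v, u] = η y ![u, X y, fderiv ℝ Y y v] := by
    rw [s12 _ (X y) u, s01 _ u (X y)]; ring
  have a4 : η y ![X y, fderiv ℝ Y y u, v] = - η y ![fderiv ℝ Y y u, X y, v] := by
    rw [s01 _ _ (X y)]
  rw [a1, a2, a3, a4]
  change (0 : ℝ) = _ at hd
  linarith

/-- If the local maps `Φ (s, ·)`, with parameters `s` in `F`, preserve `η` and `Φ (s₀, ·)` is the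
identity, then the Lie derivative of `η` vanishes along the vector field that is the derivative of
the family at `s₀` in a direction `ξ`. -/
theorem lieDeriv₃_eq_zero {F : Type*} [NormedAddCommGroup F] [NormedSpace ℝ F]
    {η : E → E [⋀^Fin 3]→L[ℝ] ℝ} {Φ : F × E → E} {s₀ : F} {y : E}
    (hη : DifferentiableAt ℝ η y) (hΦ : ContDiffAt ℝ ∞ Φ (s₀, y))
    (hid : ∀ᶠ z in 𝓝 y, Φ (s₀, z) = z)
    (hinv : ∀ᶠ s in 𝓝 s₀, ∀ v : Fin 3 → E,
      η (Φ (s, y)) (fun i => fderiv ℝ Φ (s, y) (0, v i)) = η y v) (ξ : F) (u v w : E) :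
    lieDeriv₃ η (fun z => fderiv ℝ Φ (s₀, z) (ξ, 0)) y u v w = 0 := by
  have hdΦ : HasFDerivAt (fderiv ℝ Φ) (fderiv ℝ (fderiv ℝ Φ) (s₀, y)) (s₀, y) :=
    ((hΦ.fderiv_right (m := 1) (by norm_cast)).differentiableAt (by simp)).hasFDerivAt
  have hsymm : IsSymmSndFDerivAt ℝ Φ (s₀, y) := hΦ.isSymmSndFDerivAt (by
    rw [minSmoothness_of_isRCLikeNormedField]; exact ENat.LEInfty.out)
  have hΦ₁ : HasFDerivAt Φ (fderiv ℝ Φ (s₀, y)) (s₀, y) :=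
    (hΦ.differentiableAt (by simp)).hasFDerivAt
  have hyy : Φ (s₀, y) = y := hid.self_of_nhds
  -- At `s₀`, the differential of `Φ` in the second variable is the identity.
  have hA : ∀ a, fderiv ℝ Φ (s₀, y) (0, a) = a := by
    intro a
    have h1 : HasFDerivAt (fun z => Φ (s₀, z)) _ y := hΦ₁.comp y (hasFDerivAt_prodMk_right s₀ y)
    have h2 : HasFDerivAt (fun z => Φ (s₀, z)) (ContinuousLinearMap.id ℝ E) y :=
      (hasFDerivAt_id y).congr_of_eventuallyEq hid
    exact DFunLike.congr_fun (h1.unique h2) a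
  -- The derivatives of the field and of `s ↦ d(Φ (s, ·))` are the same mixed second derivative.
  have hX : ∀ a, fderiv ℝ (fun z => fderiv ℝ Φ (s₀, z) (ξ, 0)) y a =
      fderiv ℝ (fderiv ℝ Φ) (s₀, y) (ξ, 0) (0, a) := by
    intro a
    have h1 : HasFDerivAt (fun z => fderiv ℝ Φ (s₀, z)) _ y :=
      hdΦ.comp y (hasFDerivAt_prodMk_right s₀ y)
    have h2 := h1.clm_apply (hasFDerivAt_const ((ξ, 0) : F × E) y)
    rw [h2.fderiv, hsymm.eq]
    simp
  have hB : ∀ a, ∃ L : F →L[ℝ] E, HasFDerivAt (fun s => fderiv ℝ Φ (s, y) (0, a)) L s₀ ∧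
      L ξ = fderiv ℝ (fderiv ℝ Φ) (s₀, y) (ξ, 0) (0, a) := by
    intro a
    have h1 : HasFDerivAt (fun s => fderiv ℝ Φ (s, y)) _ s₀ :=
      hdΦ.comp s₀ (hasFDerivAt_prodMk_left s₀ y)
    have h2 := h1.clm_apply (hasFDerivAt_const ((0, a) : F × E) s₀)
    exact ⟨_, h2, by simp⟩
  obtain ⟨Lu, hLu, hLu'⟩ := hB u
  obtain ⟨Lv, hLv, hLv'⟩ := hB v
  obtain ⟨Lw, hLw, hLw'⟩ := hB w
  have hηΦ : HasFDerivAt (fun s => η (Φ (s, y)))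
      ((fderiv ℝ η y).comp ((fderiv ℝ Φ (s₀, y)).comp (ContinuousLinearMap.inl ℝ F E))) s₀ := by
    have h1 : HasFDerivAt (fun s => Φ (s, y)) _ s₀ := hΦ₁.comp s₀ (hasFDerivAt_prodMk_left s₀ y)
    have h2 : HasFDerivAt η (fderiv ℝ η y) (Φ (s₀, y)) := by rw [hyy]; exact hη.hasFDerivAt
    exact h2.comp s₀ h1
  obtain ⟨L, hL, hL'⟩ := hasFDerivAt_threeForm_apply hηΦ hLu hLv hLw
  have hconst : HasFDerivAt (fun s => η (Φ (s, y)) ![fderiv ℝ Φ (s, y) (0, u),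
      fderiv ℝ Φ (s, y) (0, v), fderiv ℝ Φ (s, y) (0, w)]) (0 : F →L[ℝ] ℝ) s₀ := by
    refine (hasFDerivAt_const (η y ![u, v, w]) s₀).congr_of_eventuallyEq ?_
    filter_upwards [hinv] with s hs
    rw [← hs ![u, v, w]]
    congr 1
    ext i; fin_cases i <;> rfl
  have h := hL' ξ
  rw [hL.unique hconst, hA, hA, hA, hLu', hLv', hLw', hyy] at h
  simp only [lieDeriv₃, hX]
  exact h.symm

/-- If the vector fields `V`, `W` are `f`-related to `V'`, `W'`, then so are their brackets. -/
theorem fderiv_lieBracket_of_related {F : Type*} [NormedAddCommGroup F] [NormedSpace ℝ F]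
    {f : F → E} {V W : F → F} {V' W' : E → E} {s : F} (hf : ContDiffAt ℝ ∞ f s)
    (hV : DifferentiableAt ℝ V s) (hW : DifferentiableAt ℝ W s)
    (hV' : DifferentiableAt ℝ V' (f s)) (hW' : DifferentiableAt ℝ W' (f s))
    (hVV' : ∀ᶠ t in 𝓝 s, V' (f t) = fderiv ℝ f t (V t))
    (hWW' : ∀ᶠ t in 𝓝 s, W' (f t) = fderiv ℝ f t (W t)) :
    fderiv ℝ f s (VectorField.lieBracket ℝ V W s) =
      VectorField.lieBracket ℝ V' W' (f s) := by
  have hdf : DifferentiableAt ℝ (fderiv ℝ f) s :=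
    (hf.fderiv_right (m := 1) (by norm_cast)).differentiableAt (by simp)
  have hsymm : IsSymmSndFDerivAt ℝ f s := hf.isSymmSndFDerivAt (by
    rw [minSmoothness_of_isRCLikeNormedField]; exact ENat.LEInfty.out)
  have hfs : HasFDerivAt f (fderiv ℝ f s) s := (hf.differentiableAt (by simp)).hasFDerivAt
  have key : ∀ {U : F → F} {U' : E → E}, DifferentiableAt ℝ U s → DifferentiableAt ℝ U' (f s) →
      (∀ᶠ t in 𝓝 s, U' (f t) = fderiv ℝ f t (U t)) → ∀ ξ,
      fderiv ℝ U' (f s) (fderiv ℝ f s ξ) =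
        fderiv ℝ (fderiv ℝ f) s ξ (U s) + fderiv ℝ f s (fderiv ℝ U s ξ) := by
    intro U U' hU hU' h ξ
    have h1 : HasFDerivAt (fun t => U' (f t)) _ s := hU'.hasFDerivAt.comp s hfs
    have h2 := (hdf.hasFDerivAt.clm_apply hU.hasFDerivAt).congr_of_eventuallyEq h
    have := DFunLike.congr_fun (h1.unique h2) ξ
    simpa [add_comm] using this
  simp only [VectorField.lieBracket, map_sub]
  rw [hVV'.self_of_nhds, hWW'.self_of_nhds, key hW hW' hWW', key hV hV' hVV', hsymm.eq]
  abel

end Coordinates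

/-! ### Differentials as linear maps of the model spaces -/

section ModelDeriv

variable (E : Type*) [NormedAddCommGroup E] [NormedSpace ℝ E]
  (E' : Type*) [NormedAddCommGroup E'] [NormedSpace ℝ E']
  {E'' : Type*} [NormedAddCommGroup E''] [NormedSpace ℝ E'']
  {M : Type*} [TopologicalSpace M] [ChartedSpace E M]
  {N : Type*} [TopologicalSpace N] [ChartedSpace E' N]
  {P : Type*} [TopologicalSpace P] [ChartedSpace E'' P]

/-- The differential of `f` at `x` as a map between the model spaces. As all tangent spaces of `M`
are copies of `E`, equations between differentials at propositionally equal points can be stated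
without transport. -/
def modelDeriv (f : M → N) (x : M) : E →L[ℝ] E' :=
  mfderiv 𝓘(ℝ, E) 𝓘(ℝ, E') f x

variable {E E'}

theorem modelDeriv_eq_fderiv (f : E → E') (x : E) : modelDeriv E E' f x = fderiv ℝ f x :=
  mfderiv_eq_fderiv

theorem modelDeriv_comp {f : M → N} {g : N → P} {x : M} {y : N} (hy : f x = y)
    (hg : MDifferentiableAt 𝓘(ℝ, E') 𝓘(ℝ, E'') g y)
    (hf : MDifferentiableAt 𝓘(ℝ, E) 𝓘(ℝ, E') f x) (v : E) :
    modelDeriv E E'' (fun z => g (f z)) x v = modelDeriv E' E'' g y (modelDeriv E E' f x v) := by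
  subst hy
  exact mfderiv_comp_apply (I := 𝓘(ℝ, E)) (I' := 𝓘(ℝ, E')) (I'' := 𝓘(ℝ, E'')) x hg hf v

theorem modelDeriv_congr {f g : M → N} {x : M} (h : f =ᶠ[𝓝 x] g) :
    modelDeriv E E' f x = modelDeriv E E' g x :=
  h.mfderiv_eq

theorem modelDeriv_id (x : M) : modelDeriv E E (fun z : M => z) x = ContinuousLinearMap.id ℝ E :=
  mfderiv_id

theorem modelDeriv_const (x : M) (y : N) : modelDeriv E E' (fun _ : M => y) x = 0 :=
  mfderiv_const

end ModelDeriv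

/-! ### Differential forms in charts -/

section Charts

variable {E : Type*} [NormedAddCommGroup E] [NormedSpace ℝ E]
  {M : Type*} [TopologicalSpace M] [ChartedSpace E M]

/-- The value of a form at `x`, as an alternating map on the model space. -/
def formAt {k : ℕ} (α : FormField E M k) (x : M) : E [⋀^Fin k]→L[ℝ] ℝ := α x

theorem formAt_add {k : ℕ} (α η : FormField E M k) (x : M) :
    formAt (α + η) x = formAt α x + formAt η x := rfl

theorem formAt_smul {k : ℕ} (a : ℝ) (α : FormField E M k) (x : M) :
    formAt (a • α) x = a • formAt α x := rfl

theorem form_congr {k : ℕ} (α : FormField E M k) {x y : M} (h : x = y) {v w : Fin k → E}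
    (hvw : v = w) :
    formAt α x v = formAt α y w := by
  subst h hvw; rfl

theorem formInChart_apply {k : ℕ} (α : FormField E M k) (x₀ : M) (y : E) (v : Fin k → E) :
    formInChart α x₀ y v = formAt α ((extChartAt 𝓘(ℝ, E) x₀).symm y)
      (fun i => modelDeriv E E (extChartAt 𝓘(ℝ, E) x₀).symm y (v i)) := rfl

theorem mextDeriv_apply {k : ℕ} (α : FormField E M k) (x : M) (v : Fin (k + 1) → E) :
    formAt (mextDeriv α) x v =
      extDeriv (formInChart α x) (extChartAt 𝓘(ℝ, E) x x)
        (fun i => modelDeriv E E (extChartAt 𝓘(ℝ, E) x) x (v i)) := rfl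

theorem IsInvariantForm.apply {G : Type*} [Group G] [MulAction G M] {k : ℕ}
    {α : FormField E M k} (h : IsInvariantForm G α) (a : G) (m : M) (v : Fin k → E) :
    formAt α (a • m) (fun i => modelDeriv E E (fun z : M => a • z) m (v i)) =
      formAt α m v :=
  DFunLike.congr_fun (congrFun (h a) m) v

variable [IsManifold 𝓘(ℝ, E) ∞ M]

theorem mdifferentiableAt_extChartAt' {x₀ m : M} (hm : m ∈ (extChartAt 𝓘(ℝ, E) x₀).source) :
    MDifferentiableAt 𝓘(ℝ, E) 𝓘(ℝ, E) (extChartAt 𝓘(ℝ, E) x₀) m := by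
  have : IsManifold 𝓘(ℝ, E) 1 M := .of_le (n := ∞) ENat.LEInfty.out
  exact mdifferentiableAt_extChartAt (by simpa using hm)

theorem mdifferentiableAt_extChartAt_symm {x₀ : M} {y : E}
    (hy : y ∈ (extChartAt 𝓘(ℝ, E) x₀).target) :
    MDifferentiableAt 𝓘(ℝ, E) 𝓘(ℝ, E) (extChartAt 𝓘(ℝ, E) x₀).symm y := by
  have : IsManifold 𝓘(ℝ, E) 1 M := .of_le (n := ∞) ENat.LEInfty.out
  have h := mdifferentiableWithinAt_extChartAt_symm (I := 𝓘(ℝ, E)) hy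
  rwa [modelWithCornersSelf_coe, Set.range_id, mdifferentiableWithinAt_univ] at h

theorem modelDeriv_extChartAt_symm_apply {x₀ m : M}
    (hm : m ∈ (extChartAt 𝓘(ℝ, E) x₀).source) (v : E) :
    modelDeriv E E (extChartAt 𝓘(ℝ, E) x₀).symm (extChartAt 𝓘(ℝ, E) x₀ m)
      (modelDeriv E E (extChartAt 𝓘(ℝ, E) x₀) m v) = v := by
  rw [← modelDeriv_comp (f := extChartAt 𝓘(ℝ, E) x₀) rfl
    (mdifferentiableAt_extChartAt_symm ((extChartAt 𝓘(ℝ, E) x₀).map_source hm))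
    (mdifferentiableAt_extChartAt' hm), modelDeriv_congr (g := fun z => z), modelDeriv_id]
  · rfl
  · filter_upwards [(isOpen_extChartAt_source x₀).mem_nhds hm] with z hz
    exact (extChartAt 𝓘(ℝ, E) x₀).left_inv hz

theorem modelDeriv_extChartAt_apply_symm {x₀ : M} {y : E}
    (hy : y ∈ (extChartAt 𝓘(ℝ, E) x₀).target) (v : E) :
    modelDeriv E E (extChartAt 𝓘(ℝ, E) x₀) ((extChartAt 𝓘(ℝ, E) x₀).symm y)
      (modelDeriv E E (extChartAt 𝓘(ℝ, E) x₀).symm y v) = v := by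
  rw [← modelDeriv_comp (f := (extChartAt 𝓘(ℝ, E) x₀).symm) rfl
    (mdifferentiableAt_extChartAt' ((extChartAt 𝓘(ℝ, E) x₀).map_target hy))
    (mdifferentiableAt_extChartAt_symm hy), modelDeriv_congr (g := fun z => z), modelDeriv_id]
  · rfl
  · filter_upwards [(isOpen_extChartAt_target x₀).mem_nhds hy] with z hz
    exact (extChartAt 𝓘(ℝ, E) x₀).right_inv hz

theorem extDeriv_formInChart_of_mextDeriv_eq_zero {k : ℕ} {α : FormField E M k}
    (h : mextDeriv α = 0) (x : M) :
    extDeriv (formInChart α x) (extChartAt 𝓘(ℝ, E) x x) = 0 := by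
  ext v
  have h1 := mextDeriv_apply α x
    (fun i => modelDeriv E E (extChartAt 𝓘(ℝ, E) x).symm (extChartAt 𝓘(ℝ, E) x x) (v i))
  rw [h] at h1
  have h2 : ∀ u, modelDeriv E E (extChartAt 𝓘(ℝ, E) x) x
      (modelDeriv E E (extChartAt 𝓘(ℝ, E) x).symm (extChartAt 𝓘(ℝ, E) x x) u) = u := by
    intro u
    have := modelDeriv_extChartAt_apply_symm (mem_extChartAt_target (I := 𝓘(ℝ, E)) x) u
    rwa [extChartAt_to_inv] at this
  simp only [h2] at h1
  exact h1.symm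

end Charts

/-! ### The action in charts -/

section ActionInCharts

variable {E : Type*} [NormedAddCommGroup E] [NormedSpace ℝ E]
  {F : Type*} [NormedAddCommGroup F] [NormedSpace ℝ F]
  {M : Type*} [TopologicalSpace M] [ChartedSpace E M]
  {G : Type*} [TopologicalSpace G] [ChartedSpace F G] [Group G] [MulAction G M]

variable (E F G) in
/-- The action map `G × M → M` in the preferred charts at `1 ∈ G` and `x₀ ∈ M`. -/
def actionInCharts (x₀ : M) (p : F × E) : E :=
  extChartAt 𝓘(ℝ, E) x₀
    ((extChartAt 𝓘(ℝ, F) (1 : G)).symm p.1 • (extChartAt 𝓘(ℝ, E) x₀).symm p.2)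

variable (E F G) in
/-- The set where `actionInCharts` represents the action. -/
def actionDomain (x₀ : M) : Set (F × E) :=
  ((extChartAt 𝓘(ℝ, F) (1 : G)).target ×ˢ (extChartAt 𝓘(ℝ, E) x₀).target) ∩
    (fun p : F × E =>
      (extChartAt 𝓘(ℝ, F) (1 : G)).symm p.1 • (extChartAt 𝓘(ℝ, E) x₀).symm p.2) ⁻¹'
      (extChartAt 𝓘(ℝ, E) x₀).source

variable (E F G) in
/-- The vector field generated by `X`, in the preferred chart at `x₀`. -/
def fundamentalFieldInChart (x₀ : M) (X : F) (y : E) : E :=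
  fderiv ℝ (actionInCharts E F G x₀) (extChartAt 𝓘(ℝ, F) (1 : G) 1, y)
    (modelDeriv F F (extChartAt 𝓘(ℝ, F) (1 : G)) 1 X, 0)

theorem mk_one_mem_actionDomain {x₀ : M} {y : E} (hy : y ∈ (extChartAt 𝓘(ℝ, E) x₀).target) :
    (extChartAt 𝓘(ℝ, F) (1 : G) 1, y) ∈ actionDomain E F G x₀ := by
  refine ⟨⟨mem_extChartAt_target _, hy⟩, ?_⟩
  simp only [Set.mem_preimage, extChartAt_to_inv, one_smul]
  exact (extChartAt 𝓘(ℝ, E) x₀).map_target hy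

theorem actionInCharts_one {x₀ : M} {y : E} (hy : y ∈ (extChartAt 𝓘(ℝ, E) x₀).target) :
    actionInCharts E F G x₀ (extChartAt 𝓘(ℝ, F) (1 : G) 1, y) = y := by
  simp only [actionInCharts, extChartAt_to_inv, one_smul]
  exact (extChartAt 𝓘(ℝ, E) x₀).right_inv hy

theorem extChartAt_symm_actionInCharts {x₀ : M} {p : F × E} (hp : p ∈ actionDomain E F G x₀) :
    (extChartAt 𝓘(ℝ, E) x₀).symm (actionInCharts E F G x₀ p) =
      (extChartAt 𝓘(ℝ, F) (1 : G)).symm p.1 • (extChartAt 𝓘(ℝ, E) x₀).symm p.2 :=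
  (extChartAt 𝓘(ℝ, E) x₀).left_inv hp.2

theorem actionInCharts_mem_target {x₀ : M} {p : F × E} (hp : p ∈ actionDomain E F G x₀) :
    actionInCharts E F G x₀ p ∈ (extChartAt 𝓘(ℝ, E) x₀).target :=
  (extChartAt 𝓘(ℝ, E) x₀).map_source hp.2

variable [ContMDiffSMul 𝓘(ℝ, F) 𝓘(ℝ, E) ∞ G M]

theorem mdifferentiableAt_smul_const (a : G) (m : M) :
    MDifferentiableAt 𝓘(ℝ, F) 𝓘(ℝ, E) (fun a : G => a • m) a := by
  have h : ContMDiff 𝓘(ℝ, F) 𝓘(ℝ, E) ∞ (fun a : G => a • m) :=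
    (contMDiff_smul (I := 𝓘(ℝ, F)) (I' := 𝓘(ℝ, E)) (n := ∞)).comp
      (contMDiff_id.prodMk contMDiff_const)
  exact h.mdifferentiableAt (by simp)

theorem contMDiff_const_smul_of_contMDiffSMul (F : Type*) [NormedAddCommGroup F] [NormedSpace ℝ F]
    [ChartedSpace F G] [ContMDiffSMul 𝓘(ℝ, F) 𝓘(ℝ, E) ∞ G M] (a : G) :
    ContMDiff 𝓘(ℝ, E) 𝓘(ℝ, E) ∞ (fun m : M => a • m) :=
  (contMDiff_smul (I := 𝓘(ℝ, F)) (I' := 𝓘(ℝ, E)) (n := ∞)).comp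
      (contMDiff_const.prodMk contMDiff_id)

theorem mdifferentiableAt_const_smul (F : Type*) [NormedAddCommGroup F] [NormedSpace ℝ F]
    [ChartedSpace F G] [ContMDiffSMul 𝓘(ℝ, F) 𝓘(ℝ, E) ∞ G M] (a : G) (m : M) :
    MDifferentiableAt 𝓘(ℝ, E) 𝓘(ℝ, E) (fun m : M => a • m) m :=
  (contMDiff_const_smul_of_contMDiffSMul F a).mdifferentiableAt (by simp)

variable [IsManifold 𝓘(ℝ, E) ∞ M] [LieGroup 𝓘(ℝ, F) ∞ G]

theorem contMDiffOn_smul_extChartAt_symm (x₀ : M) :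
    ContMDiffOn 𝓘(ℝ, F × E) 𝓘(ℝ, E) ∞ (fun p : F × E =>
      (extChartAt 𝓘(ℝ, F) (1 : G)).symm p.1 • (extChartAt 𝓘(ℝ, E) x₀).symm p.2)
      ((extChartAt 𝓘(ℝ, F) (1 : G)).target ×ˢ (extChartAt 𝓘(ℝ, E) x₀).target) := by
  have h1 : ContMDiffOn 𝓘(ℝ, F × E) 𝓘(ℝ, F) ∞
      (fun p : F × E => (extChartAt 𝓘(ℝ, F) (1 : G)).symm p.1)
      ((extChartAt 𝓘(ℝ, F) (1 : G)).target ×ˢ (extChartAt 𝓘(ℝ, E) x₀).target) :=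
    (contMDiffOn_extChartAt_symm (1 : G)).comp contDiff_fst.contMDiff.contMDiffOn
      (fun p hp => hp.1)
  have h2 : ContMDiffOn 𝓘(ℝ, F × E) 𝓘(ℝ, E) ∞
      (fun p : F × E => (extChartAt 𝓘(ℝ, E) x₀).symm p.2)
      ((extChartAt 𝓘(ℝ, F) (1 : G)).target ×ˢ (extChartAt 𝓘(ℝ, E) x₀).target) :=
    (contMDiffOn_extChartAt_symm x₀).comp contDiff_snd.contMDiff.contMDiffOn
      (fun p hp => hp.2)
  exact (contMDiff_smul (I := 𝓘(ℝ, F)) (I' := 𝓘(ℝ, E))).comp_contMDiffOn (h1.prodMk h2)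

theorem isOpen_actionDomain (x₀ : M) : IsOpen (actionDomain E F G x₀) :=
  (contMDiffOn_smul_extChartAt_symm x₀).continuousOn.isOpen_inter_preimage
    ((isOpen_extChartAt_target _).prod (isOpen_extChartAt_target _)) (isOpen_extChartAt_source _)

theorem contDiffOn_actionInCharts (x₀ : M) :
    ContDiffOn ℝ ∞ (actionInCharts E F G x₀) (actionDomain E F G x₀) := by
  rw [← contMDiffOn_iff_contDiffOn]
  have h := contMDiffOn_extChartAt (I := 𝓘(ℝ, E)) (x := x₀) (n := ∞)
  rw [← extChartAt_source 𝓘(ℝ, E)] at h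
  exact h.comp ((contMDiffOn_smul_extChartAt_symm x₀).mono Set.inter_subset_left)
    (fun p hp => hp.2)

theorem contDiffAt_actionInCharts {x₀ : M} {p : F × E} (hp : p ∈ actionDomain E F G x₀) :
    ContDiffAt ℝ ∞ (actionInCharts E F G x₀) p :=
  (contDiffOn_actionInCharts x₀).contDiffAt ((isOpen_actionDomain x₀).mem_nhds hp)

theorem contDiffOn_fundamentalFieldInChart (x₀ : M) (X : F) :
    ContDiffOn ℝ ∞ (fundamentalFieldInChart E F G x₀ X) (extChartAt 𝓘(ℝ, E) x₀).target := by
  have h := (contDiffOn_actionInCharts (E := E) (F := F) (G := G) x₀).fderiv_of_isOpen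
    (m := ∞) (isOpen_actionDomain x₀) (by simp)
  have h2 : ContDiffOn ℝ ∞ (fun y : E => (extChartAt 𝓘(ℝ, F) (1 : G) 1, y))
      (extChartAt 𝓘(ℝ, E) x₀).target := (contDiff_prodMk_right _).contDiffOn
  exact (h.comp h2 (fun y hy => mk_one_mem_actionDomain hy)).clm_apply contDiffOn_const

/-- In the chart, the field generated by `X` is `fundamentalFieldInChart`. -/
theorem infinitesimalAction_extChartAt_symm {x₀ : M} {y : E}
    (hy : y ∈ (extChartAt 𝓘(ℝ, E) x₀).target) (X : F) :
    modelDeriv F E (fun a : G => a • (extChartAt 𝓘(ℝ, E) x₀).symm y) 1 X =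
      modelDeriv E E (extChartAt 𝓘(ℝ, E) x₀).symm y (fundamentalFieldInChart E F G x₀ X y) := by
  set s₀ := extChartAt 𝓘(ℝ, F) (1 : G) 1 with hs₀
  have hmem := mk_one_mem_actionDomain (F := F) (G := G) hy
  have hΦ : HasFDerivAt (fun s => actionInCharts E F G x₀ (s, y)) _ s₀ :=
    HasFDerivAt.comp (g := actionInCharts E F G x₀) s₀
      ((contDiffAt_actionInCharts hmem).differentiableAt (by simp)).hasFDerivAt
      (hasFDerivAt_prodMk_left s₀ y)
  have h1 : (fun a : G => a • (extChartAt 𝓘(ℝ, E) x₀).symm y) =ᶠ[𝓝 1]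
      fun a => (extChartAt 𝓘(ℝ, E) x₀).symm
        (actionInCharts E F G x₀ (extChartAt 𝓘(ℝ, F) (1 : G) a, y)) := by
    have hcont : ContinuousAt (fun a : G => (extChartAt 𝓘(ℝ, F) (1 : G) a, y)) 1 :=
      (continuousAt_extChartAt (1 : G)).prodMk continuousAt_const
    filter_upwards [hcont.preimage_mem_nhds ((isOpen_actionDomain x₀).mem_nhds hmem),
      extChartAt_source_mem_nhds (I := 𝓘(ℝ, F)) (1 : G)] with a ha ha'
    rw [extChartAt_symm_actionInCharts ha, (extChartAt 𝓘(ℝ, F) (1 : G)).left_inv ha']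
  have hd1 : MDifferentiableAt 𝓘(ℝ, F) 𝓘(ℝ, F) (extChartAt 𝓘(ℝ, F) (1 : G)) 1 :=
    mdifferentiableAt_extChartAt' (mem_extChartAt_source 1)
  have hd2 : MDifferentiableAt 𝓘(ℝ, F) 𝓘(ℝ, E) (fun s => actionInCharts E F G x₀ (s, y)) s₀ :=
    hΦ.differentiableAt.mdifferentiableAt
  rw [modelDeriv_congr h1,
    modelDeriv_comp (f := fun a => actionInCharts E F G x₀ (extChartAt 𝓘(ℝ, F) (1 : G) a, y))
      (actionInCharts_one hy) (mdifferentiableAt_extChartAt_symm hy) (hd2.comp 1 hd1),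
    modelDeriv_comp (f := extChartAt 𝓘(ℝ, F) (1 : G))
      (g := fun s => actionInCharts E F G x₀ (s, y)) rfl hd2 hd1, modelDeriv_eq_fderiv, hΦ.fderiv]
  rfl

theorem fundamentalFieldInChart_eq {x₀ m : M} (hm : m ∈ (extChartAt 𝓘(ℝ, E) x₀).source) (X : F) :
    fundamentalFieldInChart E F G x₀ X (extChartAt 𝓘(ℝ, E) x₀ m) =
      modelDeriv E E (extChartAt 𝓘(ℝ, E) x₀) m (modelDeriv F E (fun a : G => a • m) 1 X) := by
  have hy := (extChartAt 𝓘(ℝ, E) x₀).map_source hm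
  have h := infinitesimalAction_extChartAt_symm (G := G) hy X
  have h2 := congrArg (modelDeriv E E (extChartAt 𝓘(ℝ, E) x₀)
    ((extChartAt 𝓘(ℝ, E) x₀).symm (extChartAt 𝓘(ℝ, E) x₀ m))) h
  rw [modelDeriv_extChartAt_apply_symm hy, (extChartAt 𝓘(ℝ, E) x₀).left_inv hm] at h2
  exact h2.symm

/-- In charts, an invariant form is preserved by the local maps `actionInCharts x₀ (s, ·)`. -/
theorem IsInvariantForm.formInChart_actionInCharts {k : ℕ} {α : FormField E M k}
    (h : IsInvariantForm G α) {x₀ : M} {p : F × E} (hp : p ∈ actionDomain E F G x₀)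
    (v : Fin k → E) :
    formInChart α x₀ (actionInCharts E F G x₀ p)
      (fun i => fderiv ℝ (actionInCharts E F G x₀) p (0, v i)) = formInChart α x₀ p.2 v := by
  obtain ⟨s, y⟩ := p
  set a : G := (extChartAt 𝓘(ℝ, F) (1 : G)).symm s with ha
  have hy : y ∈ (extChartAt 𝓘(ℝ, E) x₀).target := hp.1.2
  have hΦ : HasFDerivAt (fun z => actionInCharts E F G x₀ (s, z)) _ y :=
    HasFDerivAt.comp (g := actionInCharts E F G x₀) y
      ((contDiffAt_actionInCharts hp).differentiableAt (by simp)).hasFDerivAt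
      (hasFDerivAt_prodMk_right s y)
  rw [formInChart_apply, formInChart_apply, ← h.apply a ((extChartAt 𝓘(ℝ, E) x₀).symm y)]
  refine form_congr α (extChartAt_symm_actionInCharts hp) (funext fun i => ?_)
  have h1 : (fun z => (extChartAt 𝓘(ℝ, E) x₀).symm (actionInCharts E F G x₀ (s, z))) =ᶠ[𝓝 y]
      fun z => a • (extChartAt 𝓘(ℝ, E) x₀).symm z := by
    have hcont : ContinuousAt (fun z : E => (s, z)) y := by fun_prop
    filter_upwards [hcont.preimage_mem_nhds ((isOpen_actionDomain x₀).mem_nhds hp)] with z hz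
    exact extChartAt_symm_actionInCharts hz
  have h2 := DFunLike.congr_fun (modelDeriv_congr (E := E) (E' := E) h1) (v i)
  rw [modelDeriv_comp (f := fun z => actionInCharts E F G x₀ (s, z)) rfl
      (mdifferentiableAt_extChartAt_symm (actionInCharts_mem_target hp))
      hΦ.differentiableAt.mdifferentiableAt,
    modelDeriv_comp (f := (extChartAt 𝓘(ℝ, E) x₀).symm) (g := fun z => a • z) rfl
      (mdifferentiableAt_const_smul F a _) (mdifferentiableAt_extChartAt_symm hy),
    modelDeriv_eq_fderiv, hΦ.fderiv] at h2
  exact h2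

end ActionInCharts

/-! ### The bracket of fundamental vector fields -/

section Bracket

variable {E : Type*} [NormedAddCommGroup E] [NormedSpace ℝ E]
  {F : Type*} [NormedAddCommGroup F] [NormedSpace ℝ F]
  {M : Type*} [TopologicalSpace M] [ChartedSpace E M]
  {G : Type*} [TopologicalSpace G] [ChartedSpace F G] [Group G] [MulAction G M]
  [ContMDiffSMul 𝓘(ℝ, F) 𝓘(ℝ, E) ∞ G M]
  [LieGroup 𝓘(ℝ, F) ∞ G]

theorem mdifferentiableAt_inv' (g : G) :
    MDifferentiableAt 𝓘(ℝ, F) 𝓘(ℝ, F) (fun g : G => g⁻¹) g :=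
  (contMDiff_inv 𝓘(ℝ, F) ∞).mdifferentiableAt (by simp)

/-- The differential of `a ↦ a⁻¹ • m` at `1` is minus the infinitesimal action. -/
theorem modelDeriv_inv_smul_one (m : M) (X : F) :
    modelDeriv F E (fun a : G => a⁻¹ • m) 1 X = - modelDeriv F E (fun a : G => a • m) 1 X := by
  -- Differentiate `a • a⁻¹ • m = m` at `a = 1`.
  have hp : MDifferentiableAt 𝓘(ℝ, F) (𝓘(ℝ, F).prod 𝓘(ℝ, E)) (fun a : G => (a, a⁻¹ • m)) 1 :=
    mdifferentiableAt_id.prodMk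
      ((mdifferentiableAt_smul_const (E := E) (1 : G)⁻¹ m).comp (1 : G)
        (mdifferentiableAt_inv' (F := F) 1))
  have hs : MDifferentiableAt (𝓘(ℝ, F).prod 𝓘(ℝ, E)) 𝓘(ℝ, E) (fun p : G × M => p.1 • p.2)
      ((1 : G), (1 : G)⁻¹ • m) :=
    (contMDiff_smul (I := 𝓘(ℝ, F)) (I' := 𝓘(ℝ, E)) (n := ∞)).mdifferentiableAt (by simp)
  have h1 := mfderiv_comp_apply (1 : G) hs hp X
  rw [mfderiv_prod_eq_add_apply hs] at h1
  have h2 : modelDeriv F E (fun a : G => a • a⁻¹ • m) 1 X = 0 := by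
    simp only [smul_inv_smul, modelDeriv_const]
    rfl
  have h3 : modelDeriv F E (fun a : G => a • a⁻¹ • m) 1 X =
      modelDeriv F E (fun a : G => a • (1 : G)⁻¹ • m) 1 (modelDeriv F F (fun a : G => a) 1 X) +
        modelDeriv E E (fun z : M => (1 : G) • z) ((1 : G)⁻¹ • m)
          (modelDeriv F E (fun a : G => a⁻¹ • m) 1 X) := by
    have e := MDifferentiableAt.mfderiv_prod (I := 𝓘(ℝ, F)) (I' := 𝓘(ℝ, F)) (I'' := 𝓘(ℝ, E))
      (f := fun a : G => a) (g := fun a : G => a⁻¹ • m) (x := 1) mdifferentiableAt_id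
      ((mdifferentiableAt_smul_const (E := E) (1 : G)⁻¹ m).comp (1 : G)
        (mdifferentiableAt_inv' (F := F) 1))
    rw [e] at h1
    exact h1
  simp only [inv_one, one_smul, modelDeriv_id, ContinuousLinearMap.coe_id', id_eq] at h3
  rw [h2] at h3
  exact eq_neg_of_add_eq_zero_right h3.symm

/-- The left-invariant field of `X` is related to minus the field generated by `X` under the
map `g ↦ g⁻¹ • m`. -/
theorem modelDeriv_inv_smul (g : G) (m : M) (X : F) :
    modelDeriv F E (fun a : G => a⁻¹ • m) g (modelDeriv F F (fun a : G => g * a) 1 X) =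
      - modelDeriv F E (fun a : G => a • (g⁻¹ • m)) 1 X := by
  have hd : MDifferentiableAt 𝓘(ℝ, F) 𝓘(ℝ, E) (fun a : G => a⁻¹ • m) g :=
    (mdifferentiableAt_smul_const (E := E) g⁻¹ m).comp g (mdifferentiableAt_inv' (F := F) g)
  rw [← modelDeriv_comp (f := fun a : G => g * a) (g := fun a : G => a⁻¹ • m) (mul_one g) hd
    (mdifferentiableAt_mul_left' g 1), ← modelDeriv_inv_smul_one]
  simp only [mul_inv_rev, mul_smul]

variable (F G) in
/-- The left-invariant vector field of `X` in the preferred chart at the identity. -/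
def invariantFieldInChart (X : F) : F → F :=
  VectorField.mpullback 𝓘(ℝ, F) 𝓘(ℝ, F) (extChartAt 𝓘(ℝ, F) (1 : G)).symm
    (mulInvariantVectorField (I := 𝓘(ℝ, F)) (G := G) X)

variable (G) in
/-- The bracket of the Lie algebra of `G`, as an operation on the model space `F`. -/
def modelBracket (X Y : F) : F :=
  Bracket.bracket (L := GroupLieAlgebra 𝓘(ℝ, F) G) (M := GroupLieAlgebra 𝓘(ℝ, F) G) X Y

theorem invariantFieldInChart_apply {s : F} (hs : s ∈ (extChartAt 𝓘(ℝ, F) (1 : G)).target)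
    (X : F) :
    modelDeriv F F (extChartAt 𝓘(ℝ, F) (1 : G)).symm s (invariantFieldInChart F G X s) =
      modelDeriv F F (fun a : G => (extChartAt 𝓘(ℝ, F) (1 : G)).symm s * a) 1 X := by
  have : IsManifold 𝓘(ℝ, F) 1 G := .of_le (n := ∞) ENat.LEInfty.out
  have hinv : (mfderiv 𝓘(ℝ, F) 𝓘(ℝ, F) (extChartAt 𝓘(ℝ, F) (1 : G)).symm s).IsInvertible := by
    have := isInvertible_mfderivWithin_extChartAt_symm (I := 𝓘(ℝ, F)) hs
    simpa using this
  exact ((hinv.inverse_apply_eq).1 rfl).symm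

theorem invariantFieldInChart_one (X : F) :
    invariantFieldInChart F G X (extChartAt 𝓘(ℝ, F) (1 : G) 1) =
      modelDeriv F F (extChartAt 𝓘(ℝ, F) (1 : G)) 1 X := by
  have hs := mem_extChartAt_target (I := 𝓘(ℝ, F)) (1 : G)
  have h := congrArg (modelDeriv F F (extChartAt 𝓘(ℝ, F) (1 : G)) ((extChartAt 𝓘(ℝ, F) (1 : G)).symm
    (extChartAt 𝓘(ℝ, F) (1 : G) 1))) (invariantFieldInChart_apply hs X)
  rw [modelDeriv_extChartAt_apply_symm hs] at h
  simpa only [extChartAt_to_inv, one_mul, modelDeriv_id, ContinuousLinearMap.coe_id',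
    id_eq] using h

/-- The Lie algebra bracket is the bracket of left-invariant fields, computed in the chart at `1`. -/
theorem modelDeriv_extChartAt_bracket (X Y : F) :
    modelDeriv F F (extChartAt 𝓘(ℝ, F) (1 : G)) 1 (modelBracket G X Y) =
      VectorField.lieBracket ℝ (invariantFieldInChart F G X) (invariantFieldInChart F G Y)
        (extChartAt 𝓘(ℝ, F) (1 : G) 1) := by
  have : IsManifold 𝓘(ℝ, F) 1 G := .of_le (n := ∞) ENat.LEInfty.out
  have hinv : (mfderiv 𝓘(ℝ, F) 𝓘(ℝ, F) (extChartAt 𝓘(ℝ, F) (1 : G)) 1).IsInvertible :=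
    isInvertible_mfderiv_extChartAt (mem_extChartAt_source 1)
  have h1 := VectorField.mlieBracketWithin_apply (I := 𝓘(ℝ, F)) (M := G) (s := Set.univ)
    (V := mulInvariantVectorField X) (W := mulInvariantVectorField Y) (x₀ := (1 : G))
  simp only [modelWithCornersSelf_coe, Set.range_id, Set.preimage_univ,
    Set.inter_self, VectorField.mpullbackWithin_univ, VectorField.mlieBracketWithin_univ] at h1
  have h2 : VectorField.lieBracketWithin ℝ (invariantFieldInChart F G X)
      (invariantFieldInChart F G Y) Set.univ (extChartAt 𝓘(ℝ, F) (1 : G) 1) =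
      VectorField.lieBracket ℝ (invariantFieldInChart F G X) (invariantFieldInChart F G Y)
        (extChartAt 𝓘(ℝ, F) (1 : G) 1) := by
    rw [VectorField.lieBracketWithin_univ]
  exact ((hinv.inverse_apply_eq).1 h1.symm).symm.trans h2

variable [FiniteDimensional ℝ F]

theorem differentiableAt_invariantFieldInChart (X : F) :
    DifferentiableAt ℝ (invariantFieldInChart F G X) (extChartAt 𝓘(ℝ, F) (1 : G) 1) := by
  have : IsManifold 𝓘(ℝ, F) 2 G := .of_le (n := ∞) ENat.LEInfty.out
  have h := (mdifferentiableAt_mulInvariantVectorField (I := 𝓘(ℝ, F)) (G := G) X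
    (g := 1)).mdifferentiableWithinAt (s := Set.univ)
  have h2 := h.differentiableWithinAt_mpullbackWithin_vectorField
  simp only [modelWithCornersSelf_coe, Set.range_id, Set.preimage_univ, Set.inter_self,
    VectorField.mpullbackWithin_univ] at h2
  exact differentiableWithinAt_univ.1 h2

variable [IsManifold 𝓘(ℝ, E) ∞ M]

/-- The infinitesimal action is an antihomomorphism: in the chart at `x`, the bracket of the fields
generated by `X` and `Y` is at `x` minus the field generated by `⁅X, Y⁆`. -/
theorem lieBracket_fundamentalFieldInChart (x : M) (X Y : F) :
    VectorField.lieBracket ℝ (fundamentalFieldInChart E F G x X)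
      (fundamentalFieldInChart E F G x Y) (extChartAt 𝓘(ℝ, E) x x) =
      - fundamentalFieldInChart E F G x (modelBracket G X Y)
        (extChartAt 𝓘(ℝ, E) x x) := by
  -- In charts, `f` is `g ↦ g⁻¹ • x`. It relates left-invariant fields to minus the generated ones.
  set s₀ := extChartAt 𝓘(ℝ, F) (1 : G) 1 with hs₀
  set f : F → E := fun s => extChartAt 𝓘(ℝ, E) x
    (((extChartAt 𝓘(ℝ, F) (1 : G)).symm s)⁻¹ • x) with hf
  set U : Set F := (extChartAt 𝓘(ℝ, F) (1 : G)).target ∩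
    (fun s => ((extChartAt 𝓘(ℝ, F) (1 : G)).symm s)⁻¹ • x) ⁻¹' (extChartAt 𝓘(ℝ, E) x).source
    with hU
  have hsm : ContMDiffOn 𝓘(ℝ, F) 𝓘(ℝ, E) ∞
      (fun s => ((extChartAt 𝓘(ℝ, F) (1 : G)).symm s)⁻¹ • x)
      (extChartAt 𝓘(ℝ, F) (1 : G)).target :=
    (contMDiff_smul (I := 𝓘(ℝ, F)) (I' := 𝓘(ℝ, E))).comp_contMDiffOn
      (((contMDiff_inv 𝓘(ℝ, F) ∞).comp_contMDiffOn
        (contMDiffOn_extChartAt_symm (1 : G))).prodMk contMDiffOn_const)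
  have hUo : IsOpen U := hsm.continuousOn.isOpen_inter_preimage (isOpen_extChartAt_target _)
    (isOpen_extChartAt_source _)
  have hs₀U : s₀ ∈ U := ⟨mem_extChartAt_target _, by
    simp only [hs₀, Set.mem_preimage, extChartAt_to_inv, inv_one, one_smul]
    exact mem_extChartAt_source x⟩
  have hfs₀ : f s₀ = extChartAt 𝓘(ℝ, E) x x := by
    simp only [hf, hs₀, extChartAt_to_inv, inv_one, one_smul]
  have hfU : ContDiffOn ℝ ∞ f U := by
    rw [← contMDiffOn_iff_contDiffOn]
    have h := contMDiffOn_extChartAt (I := 𝓘(ℝ, E)) (x := x) (n := ∞)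
    rw [← extChartAt_source 𝓘(ℝ, E)] at h
    exact h.comp (hsm.mono Set.inter_subset_left) (fun p hp => hp.2)
  have hft : ContDiffAt ℝ ∞ f s₀ := hfU.contDiffAt (hUo.mem_nhds hs₀U)
  have hrel : ∀ Z : F, ∀ s ∈ U, - fundamentalFieldInChart E F G x Z (f s) =
      fderiv ℝ f s (invariantFieldInChart F G Z s) := by
    intro Z s hs
    have hd : MDifferentiableAt 𝓘(ℝ, F) 𝓘(ℝ, E) (fun a : G => a⁻¹ • x)
        ((extChartAt 𝓘(ℝ, F) (1 : G)).symm s) :=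
      (mdifferentiableAt_smul_const (E := E) _ x).comp _ (mdifferentiableAt_inv' (F := F) _)
    have hd2 := mdifferentiableAt_extChartAt_symm hs.1
    rw [← modelDeriv_eq_fderiv,
      modelDeriv_comp (f := fun s => ((extChartAt 𝓘(ℝ, F) (1 : G)).symm s)⁻¹ • x) rfl
        (mdifferentiableAt_extChartAt' hs.2) (hd.comp s hd2),
      modelDeriv_comp (f := (extChartAt 𝓘(ℝ, F) (1 : G)).symm)
        (g := fun a : G => a⁻¹ • x) rfl hd hd2,
      invariantFieldInChart_apply hs.1, modelDeriv_inv_smul, map_neg,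
      ← fundamentalFieldInChart_eq hs.2]
  have hdiff : ∀ Z : F, DifferentiableAt ℝ (fun y => - fundamentalFieldInChart E F G x Z y)
      (f s₀) := fun Z => by
    rw [hfs₀]
    exact (((contDiffOn_fundamentalFieldInChart x Z).contDiffAt
      (extChartAt_target_mem_nhds x)).differentiableAt (by simp)).neg
  have h := fderiv_lieBracket_of_related hft (differentiableAt_invariantFieldInChart (G := G) X)
    (differentiableAt_invariantFieldInChart (G := G) Y) (hdiff X) (hdiff Y)
    (Filter.eventually_of_mem (hUo.mem_nhds hs₀U) (hrel X))
    (Filter.eventually_of_mem (hUo.mem_nhds hs₀U) (hrel Y))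
  have hZ : invariantFieldInChart F G (modelBracket G X Y) s₀ =
      modelDeriv F F (extChartAt 𝓘(ℝ, F) (1 : G)) 1 (modelBracket G X Y) :=
    invariantFieldInChart_one _
  rw [← modelDeriv_extChartAt_bracket, ← hZ, ← hrel _ s₀ hs₀U, hfs₀] at h
  rw [h]
  simp only [VectorField.lieBracket]
  rw [fderiv_fun_neg, fderiv_fun_neg]
  simp

end Bracket

/-! ### The one-forms `p ⌟ c` -/

section Contraction

theorem contDiffOn_threeForm_apply {E : Type*} [NormedAddCommGroup E] [NormedSpace ℝ E]
    {η : E → E [⋀^Fin 3]→L[ℝ] ℝ} {X Y : E → E} {s : Set E}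
    (hη : ContDiffOn ℝ ∞ η s) (hX : ContDiffOn ℝ ∞ X s) (hY : ContDiffOn ℝ ∞ Y s) (v : E) :
    ContDiffOn ℝ ∞ (fun y => η y ![X y, Y y, v]) s := by
  have h1 : ContDiff ℝ ∞ (fun p : (E [⋀^Fin 3]→L[ℝ] ℝ) × (Fin 3 → E) => p.1 p.2) :=
    (ContinuousLinearMap.analyticOnNhd_uncurry_of_multilinear
      (ContinuousAlternatingMap.toContinuousMultilinearMapCLM ℝ :
        (E [⋀^Fin 3]→L[ℝ] ℝ) →L[ℝ] ContinuousMultilinearMap ℝ (fun _ : Fin 3 => E) ℝ)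
      (s := Set.univ)).contDiff
  refine h1.comp_contDiffOn (hη.prodMk (contDiffOn_pi.2 fun i => ?_))
  fin_cases i
  exacts [hX, hY, contDiffOn_const]

theorem contractBivector_ιMulti {V : Type*} [AddCommGroup V] [Module ℝ V] [TopologicalSpace V]
    (γ : V [⋀^Fin 3]→L[ℝ] ℝ) (v : V) (X : Fin 2 → V) :
    contractBivector γ v (exteriorPower.ιMulti ℝ 2 X) = γ ![X 0, X 1, v] := by
  simp [contractBivector]

theorem contractBivector_add {V : Type*} [AddCommGroup V] [Module ℝ V] [TopologicalSpace V]
    (γ : V [⋀^Fin 3]→L[ℝ] ℝ) (v w : V) :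
    contractBivector γ (v + w) = contractBivector γ v + contractBivector γ w := by
  apply exteriorPower.linearMap_ext
  ext X
  have hu (z : V) : Function.update ![X 0, X 1, v] 2 z = ![X 0, X 1, z] := by
    ext j; fin_cases j <;> rfl
  have h := γ.map_update_add ![X 0, X 1, v] 2 v w
  rw [hu, hu, hu] at h
  simpa [contractBivector_ιMulti] using h

theorem contractBivector_smul {V : Type*} [AddCommGroup V] [Module ℝ V] [TopologicalSpace V]
    (γ : V [⋀^Fin 3]→L[ℝ] ℝ) (a : ℝ) (v : V) :
    contractBivector γ (a • v) = a • contractBivector γ v := by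
  apply exteriorPower.linearMap_ext
  ext X
  have hu (z : V) : Function.update ![X 0, X 1, v] 2 z = ![X 0, X 1, z] := by
    ext j; fin_cases j <;> rfl
  have h := γ.map_update_smul ![X 0, X 1, v] 2 a v
  rw [hu, hu] at h
  simpa [contractBivector_ιMulti] using h

/-- Contraction is compatible with pullback along a linear map. -/
theorem contractBivector_map {V W : Type*} [AddCommGroup V] [Module ℝ V] [TopologicalSpace V]
    [AddCommGroup W] [Module ℝ W] [TopologicalSpace W] (γ : W [⋀^Fin 3]→L[ℝ] ℝ) (A : V →L[ℝ] W)
    (v : V) (q : ⋀[ℝ]^2 V) :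
    contractBivector γ (A v) (exteriorPower.map 2 A.toLinearMap q) =
      contractBivector (γ.compContinuousLinearMap A) v q := by
  have h : (contractBivector γ (A v)) ∘ₗ exteriorPower.map 2 A.toLinearMap =
      contractBivector (γ.compContinuousLinearMap A) v := by
    apply exteriorPower.linearMap_ext
    ext X
    simp only [LinearMap.compAlternatingMap_apply, LinearMap.comp_apply,
      exteriorPower.map_apply_ιMulti, contractBivector_ιMulti]
    change γ _ = γ _
    congr 1
    ext j; fin_cases j <;> rfl
  exact DFunLike.congr_fun h q

variable {E : Type*} [NormedAddCommGroup E] [NormedSpace ℝ E]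
  {M : Type*} [TopologicalSpace M] [ChartedSpace E M]
  {F : Type*} [NormedAddCommGroup F] [NormedSpace ℝ F]
  {G : Type*} [TopologicalSpace G] [ChartedSpace F G] [Group G] [MulAction G M]

/-- An element of the Lie algebra as a vector of the model space of the group. -/
def toModel (X : GroupLieAlgebra 𝓘(ℝ, F) G) : F := X

variable (E F G) in
/-- The infinitesimal action at `m`, with values in the model space of `M`. -/
def fundamentalVector (m : M) : GroupLieAlgebra 𝓘(ℝ, F) G →ₗ[ℝ] E :=
  infinitesimalAction E F G m

theorem fundamentalVector_apply (m : M) (X : GroupLieAlgebra 𝓘(ℝ, F) G) :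
    fundamentalVector E F G m X = modelDeriv F E (fun a : G => a • m) 1 (toModel X) := rfl

variable [FiniteDimensional ℝ E]

/-- A one-form is smooth if its values on constant vectors are smooth in charts. -/
theorem isSmoothForm_one_of_apply {α : FormField E M 1}
    (h : ∀ (x₀ : M) (v : E), ContDiffOn ℝ ∞ (fun y => formInChart α x₀ y ![v])
      (extChartAt 𝓘(ℝ, E) x₀).target) : IsSmoothForm α := by
  intro x₀
  have h1 : ContDiffOn ℝ ∞ (fun y =>
      (ContinuousAlternatingMap.ofSubsingletonLIE (𝕜 := ℝ) (E := E) (F := ℝ) (0 : Fin 1)).symm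
        (formInChart α x₀ y))
      (extChartAt 𝓘(ℝ, E) x₀).target := by
    rw [contDiffOn_clm_apply]
    intro v
    refine (h x₀ v).congr fun y _ => ?_
    change formInChart α x₀ y _ = formInChart α x₀ y _
    congr 1
    ext i; fin_cases i; rfl
  have h2 := (ContinuousAlternatingMap.ofSubsingletonLIE (𝕜 := ℝ) (E := E) (F := ℝ)
    (0 : Fin 1)).contDiff.comp_contDiffOn
    (n := ∞) h1
  exact h2.congr fun y _ => by simp

/-- The one-form `p ⌟ c`. -/
def contractionForm (c : FormField E M 3) (p : ⋀[ℝ]^2 (GroupLieAlgebra 𝓘(ℝ, F) G)) :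
    FormField E M 1 := fun m =>
  let A : E →ₗ[ℝ] ℝ :=
    { toFun := fun v => contractBivector (formAt c m) v
        (exteriorPower.map 2 (fundamentalVector E F G m) p)
      map_add' := fun v w => DFunLike.congr_fun (contractBivector_add (formAt c m) v w) _
      map_smul' := fun a v => DFunLike.congr_fun (contractBivector_smul (formAt c m) a v) _ }
  ContinuousAlternatingMap.ofSubsingleton ℝ E ℝ (0 : Fin 1) (LinearMap.toContinuousLinearMap A)

theorem contractionForm_apply (c : FormField E M 3) (p : ⋀[ℝ]^2 (GroupLieAlgebra 𝓘(ℝ, F) G))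
    (m : M) (v : Fin 1 → E) :
    formAt (contractionForm c p) m v = contractBivector (formAt c m) (v 0)
      (exteriorPower.map 2 (fundamentalVector E F G m) p) := rfl

theorem contractionForm_add (c : FormField E M 3) (p q : ⋀[ℝ]^2 (GroupLieAlgebra 𝓘(ℝ, F) G)) :
    contractionForm c (p + q) = contractionForm c p + contractionForm c q := by
  funext m
  refine ContinuousAlternatingMap.ext fun (v : Fin 1 → E) => ?_
  change formAt (contractionForm c (p + q)) m v =
    formAt (contractionForm c p) m v + formAt (contractionForm c q) m v
  simp only [contractionForm_apply, map_add]

theorem contractionForm_smul (c : FormField E M 3) (a : ℝ)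
    (p : ⋀[ℝ]^2 (GroupLieAlgebra 𝓘(ℝ, F) G)) :
    contractionForm c (a • p) = a • contractionForm c p := by
  funext m
  refine ContinuousAlternatingMap.ext fun (v : Fin 1 → E) => ?_
  change formAt (contractionForm c (a • p)) m v = a • formAt (contractionForm c p) m v
  simp only [contractionForm_apply, map_smul]

theorem contractionForm_ιMulti (c : FormField E M 3) (X : Fin 2 → GroupLieAlgebra 𝓘(ℝ, F) G)
    (m : M) (v : E) :
    formAt (contractionForm c (exteriorPower.ιMulti ℝ 2 X)) m ![v] =
      formAt c m ![fundamentalVector E F G m (X 0), fundamentalVector E F G m (X 1), v] := by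
  rw [contractionForm_apply, exteriorPower.map_apply_ιMulti, contractBivector_ιMulti]
  rfl

variable [ContMDiffSMul 𝓘(ℝ, F) 𝓘(ℝ, E) ∞ G M] [LieGroup 𝓘(ℝ, F) ∞ G]
  [IsManifold 𝓘(ℝ, E) ∞ M]

/-- In charts, `(X₀ ∧ X₁) ⌟ c` is the contraction of `c` with the fields generated by `X₀`
and `X₁`. -/
theorem formInChart_contractionForm_ιMulti (c : FormField E M 3)
    (X : Fin 2 → GroupLieAlgebra 𝓘(ℝ, F) G) {x₀ : M} {y : E}
    (hy : y ∈ (extChartAt 𝓘(ℝ, E) x₀).target) (v : E) :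
    formInChart (contractionForm c (exteriorPower.ιMulti ℝ 2 X)) x₀ y ![v] =
      formInChart c x₀ y ![fundamentalFieldInChart E F G x₀ (toModel (X 0)) y,
        fundamentalFieldInChart E F G x₀ (toModel (X 1)) y, v] := by
  have h1 : (fun i => modelDeriv E E (extChartAt 𝓘(ℝ, E) x₀).symm y (![v] i)) =
      ![modelDeriv E E (extChartAt 𝓘(ℝ, E) x₀).symm y v] := by
    ext i; fin_cases i; rfl
  rw [formInChart_apply, formInChart_apply, h1, contractionForm_ιMulti,
    fundamentalVector_apply, fundamentalVector_apply, infinitesimalAction_extChartAt_symm hy,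
    infinitesimalAction_extChartAt_symm hy]
  refine form_congr c rfl ?_
  ext i; fin_cases i <;> rfl

variable [FiniteDimensional ℝ F]

theorem bracketMap_ιMulti (X : Fin 2 → GroupLieAlgebra 𝓘(ℝ, F) G) :
    bracketMap (GroupLieAlgebra 𝓘(ℝ, F) G) (exteriorPower.ιMulti ℝ 2 X) = ⁅X 0, X 1⁆ := by
  simp [bracketMap, bracketAlternating]

/-- For a closed invariant three-form `c` and `p ∈ Λ²g`, the one-form `p ⌟ c` is smooth and
`d(p ⌟ c) = -c(·, L(p), ·)`. The sign is that of the brackets of generated fields. -/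
theorem contractionForm_smooth_and_mextDeriv {c : FormField E M 3} (hc : c ∈ closedForms E M 3)
    (hGc : IsInvariantForm G c) (p : ⋀[ℝ]^2 (GroupLieAlgebra 𝓘(ℝ, F) G)) :
    IsSmoothForm (contractionForm c p) ∧ ∀ (x : M) (u v : E),
      formAt (mextDeriv (contractionForm c p)) x ![u, v] =
        -formAt c x ![u, fundamentalVector E F G x (bracketMap _ p), v] := by
  have hp : p ∈ Submodule.span ℝ (Set.range (exteriorPower.ιMulti ℝ 2
      (M := GroupLieAlgebra 𝓘(ℝ, F) G))) := by
    rw [exteriorPower.ιMulti_span]; trivial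
  induction hp using Submodule.span_induction with
  | zero =>
    have h0 : contractionForm c (0 : ⋀[ℝ]^2 (GroupLieAlgebra 𝓘(ℝ, F) G)) = 0 := by
      have := contractionForm_smul c 0 (0 : ⋀[ℝ]^2 (GroupLieAlgebra 𝓘(ℝ, F) G))
      simpa using this
    rw [h0]
    refine ⟨fun x₀ => by rw [formInChart_zero]; exact contDiffOn_const, fun x u v => ?_⟩
    rw [mextDeriv_zero, map_zero, map_zero, ← zero_smul ℝ (0 : E), threeForm_smul₁, zero_mul,
      neg_zero]
    rfl
  | add p q _ _ ihp ihq =>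
    rw [contractionForm_add]
    refine ⟨fun x₀ => ?_, fun x u v => ?_⟩
    · rw [formInChart_add]; exact (ihp.1 x₀).add (ihq.1 x₀)
    · rw [mextDeriv_add ihp.1 ihq.1, map_add, map_add, threeForm_add₁, neg_add, ← ihp.2, ← ihq.2,
        formAt_add]
      rfl
  | smul a p _ ih =>
    rw [contractionForm_smul]
    refine ⟨fun x₀ => ?_, fun x u v => ?_⟩
    · rw [formInChart_smul]; exact contDiffOn_const.smul (ih.1 x₀)
    · rw [mextDeriv_smul, map_smul, map_smul, threeForm_smul₁, ← mul_neg, ← ih.2, formAt_smul]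
      rfl
  | mem p hp =>
    obtain ⟨X, rfl⟩ := hp
    have hXs := fun (x₀ : M) (Z : F) => contDiffOn_fundamentalFieldInChart (E := E) (G := G) x₀ Z
    have hsm : IsSmoothForm (contractionForm c (exteriorPower.ιMulti ℝ 2 X)) := by
      refine isSmoothForm_one_of_apply fun x₀ v => ?_
      exact (contDiffOn_threeForm_apply (hc.1 x₀) (hXs x₀ (toModel (X 0)))
        (hXs x₀ (toModel (X 1))) v).congr
        fun y hy => formInChart_contractionForm_ιMulti c X hy v
    refine ⟨hsm, fun x u v => ?_⟩
    set y := extChartAt 𝓘(ℝ, E) x x with hy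
    have hyt : y ∈ (extChartAt 𝓘(ℝ, E) x).target := mem_extChartAt_target x
    have hnhds : (extChartAt 𝓘(ℝ, E) x).target ∈ 𝓝 y := extChartAt_target_mem_nhds x
    have hXd : ∀ Z : F, DifferentiableAt ℝ (fundamentalFieldInChart E F G x Z) y := fun Z =>
      ((hXs x Z).contDiffAt hnhds).differentiableAt (by simp)
    -- Invariance of `c` makes its Lie derivatives along generated fields vanish.
    have hL : ∀ (Z : F) u v w, lieDeriv₃ (formInChart c x)
        (fundamentalFieldInChart E F G x Z) y u v w = 0 := by
      intro Z u v w
      have hmem := mk_one_mem_actionDomain (F := F) (G := G) hyt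
      refine lieDeriv₃_eq_zero (hc.1.differentiableAt x) (contDiffAt_actionInCharts hmem)
        (Filter.eventually_of_mem hnhds fun z hz => actionInCharts_one hz) ?_ _ u v w
      have hcont : ContinuousAt (fun s : F => (s, y)) (extChartAt 𝓘(ℝ, F) (1 : G) 1) := by fun_prop
      filter_upwards [hcont.preimage_mem_nhds ((isOpen_actionDomain x).mem_nhds hmem)] with s hs v
      exact hGc.formInChart_actionInCharts hs v
    have key := extDeriv_contraction (hc.1.differentiableAt x) (hXd (toModel (X 0)))
      (hXd (toModel (X 1))) (hsm.differentiableAt x)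
      (fun v => Filter.eventually_of_mem hnhds
        fun z hz => formInChart_contractionForm_ιMulti c X hz v)
      (extDeriv_formInChart_of_mextDeriv_eq_zero hc.2 x) (hL (toModel (X 0))) (hL (toModel (X 1)))
      (modelDeriv E E (extChartAt 𝓘(ℝ, E) x) x u) (modelDeriv E E (extChartAt 𝓘(ℝ, E) x) x v)
    have hbr := lieBracket_fundamentalFieldInChart (E := E) (F := F) (G := G) x
      (toModel (X 0)) (toModel (X 1))
    rw [VectorField.lieBracket] at hbr
    rw [← hy, hbr, fundamentalFieldInChart_eq (mem_extChartAt_source x), ← neg_one_smul ℝ,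
      threeForm_smul₁, formInChart_apply] at key
    have hA : (fun i => modelDeriv E E (extChartAt 𝓘(ℝ, E) x) x (![u, v] i)) =
        ![modelDeriv E E (extChartAt 𝓘(ℝ, E) x) x u,
          modelDeriv E E (extChartAt 𝓘(ℝ, E) x) x v] := by
      ext i; fin_cases i <;> rfl
    have hBA := modelDeriv_extChartAt_symm_apply (mem_extChartAt_source (I := 𝓘(ℝ, E)) x)
    rw [mextDeriv_apply, bracketMap_ιMulti, hA, key, fundamentalVector_apply, neg_one_mul]
    refine congrArg Neg.neg (form_congr c (extChartAt_to_inv x) ?_)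
    ext i; fin_cases i
    exacts [hBA _, hBA _, hBA _]

end Contraction

/-! ### A primitive of the contraction, and its defect of equivariance -/

section Primitive

variable {E : Type*} [NormedAddCommGroup E] [NormedSpace ℝ E]
  {M : Type*} [TopologicalSpace M] [ChartedSpace E M]

theorem exists_eq_differential (hb : firstBetti E M = 0) {α : FormField E M 1}
    (hα : α ∈ closedForms E M 1) :
    ∃ f : M → ℝ, ContMDiff 𝓘(ℝ, E) 𝓘(ℝ, ℝ) ∞ f ∧ α = differential f := by
  have hsub : Subsingleton (DeRhamH1 E M) := rank_zero_iff.1 hb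
  have h0 : (Submodule.Quotient.mk ⟨α, hα⟩ : DeRhamH1 E M) = 0 := Subsingleton.elim _ _
  exact (Submodule.Quotient.mk_eq_zero _).1 h0

theorem modelDeriv_sum_smul {ι : Type*} (s : Finset ι) (r : ι → ℝ) {f : ι → M → ℝ}
    (hf : ∀ i, MDifferentiable 𝓘(ℝ, E) 𝓘(ℝ, ℝ) (f i)) (m : M) (v : E) :
    modelDeriv E ℝ (fun m => ∑ i ∈ s, r i • f i m) m v =
      ∑ i ∈ s, r i • modelDeriv E ℝ (f i) m v := by
  classical
  have key : MDifferentiableAt 𝓘(ℝ, E) 𝓘(ℝ, ℝ) (fun m => ∑ i ∈ s, r i • f i m) m ∧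
      modelDeriv E ℝ (fun m => ∑ i ∈ s, r i • f i m) m v =
        ∑ i ∈ s, r i • modelDeriv E ℝ (f i) m v := by
    induction s using Finset.induction_on with
    | empty =>
      simp only [Finset.sum_empty, modelDeriv_const]
      exact ⟨mdifferentiableAt_const, rfl⟩
    | insert i s hi ih =>
      simp only [Finset.sum_insert hi]
      have h1 : MDifferentiableAt 𝓘(ℝ, E) 𝓘(ℝ, ℝ) (fun m => r i • f i m) m :=
        (hf i m).const_smul (r i)
      refine ⟨h1.add ih.1, ?_⟩
      have h2 : modelDeriv E ℝ (fun m => r i • f i m + ∑ j ∈ s, r j • f j m) m =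
          modelDeriv E ℝ (fun m => r i • f i m) m +
            modelDeriv E ℝ (fun m => ∑ j ∈ s, r j • f j m) m := mfderiv_add h1 ih.1
      have h3 : modelDeriv E ℝ (fun m => r i • f i m) m = r i • modelDeriv E ℝ (f i) m :=
        const_smul_mfderiv (hf i m) (r i)
      rw [h2, add_apply, ih.2, h3]
      rfl
  exact key.2

/-- A function with vanishing differential is constant on connected components. -/
theorem eq_of_modelDeriv_eq_zero [IsManifold 𝓘(ℝ, E) ∞ M] {f : M → ℝ}
    (hf : MDifferentiable 𝓘(ℝ, E) 𝓘(ℝ, ℝ) f) (hf' : ∀ m, modelDeriv E ℝ f m = 0) {x y : M}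
    (hxy : x ∈ connectedComponent y) : f x = f y := by
  have hloc : IsLocallyConstant f := by
    rw [IsLocallyConstant.iff_eventually_eq]
    intro m
    set φ := extChartAt 𝓘(ℝ, E) m with hφ
    obtain ⟨r, hr, hball⟩ := Metric.isOpen_iff.1 (isOpen_extChartAt_target (I := 𝓘(ℝ, E)) m) _
      (mem_extChartAt_target m)
    have hd : ∀ z ∈ Metric.ball (φ m) r,
        MDifferentiableAt 𝓘(ℝ, E) 𝓘(ℝ, ℝ) (fun z => f (φ.symm z)) z := fun z hz =>
      (hf _).comp z (mdifferentiableAt_extChartAt_symm (hball hz))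
    have hconst : ∀ z ∈ Metric.ball (φ m) r, f (φ.symm z) = f (φ.symm (φ m)) := by
      intro z hz
      refine Metric.isOpen_ball.is_const_of_fderiv_eq_zero (𝕜 := ℝ)
        (f := fun z => f (φ.symm z)) (convex_ball _ _).isPreconnected
        (fun w hw => (hd w hw).differentiableAt.differentiableWithinAt) (fun w hw => ?_) hz
        (Metric.mem_ball_self hr)
      ext v
      rw [← modelDeriv_eq_fderiv, modelDeriv_comp (f := φ.symm) rfl (hf _)
        (mdifferentiableAt_extChartAt_symm (hball hw)), hf']
      rfl
    filter_upwards [(continuousAt_extChartAt (I := 𝓘(ℝ, E)) m).preimage_mem_nhds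
      (Metric.ball_mem_nhds _ hr), extChartAt_source_mem_nhds (I := 𝓘(ℝ, E)) m] with z hz hz'
    have := hconst _ hz
    rwa [φ.left_inv hz', φ.left_inv (mem_extChartAt_source m)] at this
  exact hloc.apply_eq_of_isPreconnected isPreconnected_connectedComponent hxy
    mem_connectedComponent

theorem linearMap_apply_eq_sum_repr {V ι : Type*} [AddCommMonoid V] [Module ℝ V] [Fintype ι]
    {S : Submodule ℝ V} (b : Module.Basis ι ℝ S) (L : V →ₗ[ℝ] ℝ) (p : S) :
    L p = ∑ i, b.repr p i • L (b i) := by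
  have h := congrArg (L ∘ₗ S.subtype) (b.sum_repr p)
  rw [map_sum] at h
  simpa using h.symm

variable {F : Type*} [NormedAddCommGroup F] [NormedSpace ℝ F]
  {G : Type*} [TopologicalSpace G] [ChartedSpace F G] [Group G] [MulAction G M]

section

variable [FiniteDimensional ℝ E]

/-- The value of `p ⌟ c` at a tangent vector, as a linear function of `p`. -/
def contractionFormEval (c : FormField E M 3) (m : M) (v : E) :
    ⋀[ℝ]^2 (GroupLieAlgebra 𝓘(ℝ, F) G) →ₗ[ℝ] ℝ :=
  contractBivector (formAt c m) v ∘ₗ exteriorPower.map 2 (fundamentalVector E F G m)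

theorem contractionFormEval_apply (c : FormField E M 3) (m : M) (v : E)
    (p : ⋀[ℝ]^2 (GroupLieAlgebra 𝓘(ℝ, F) G)) :
    contractionFormEval c m v p = formAt (contractionForm c p) m ![v] := rfl

/-- The one-form `p ⌟ c` agrees with the contraction in the definition of a multi-moment map. -/
theorem contractBivector_generatedBivector (c : FormField E M 3) (m : M)
    (v : TangentSpace 𝓘(ℝ, E) m) (p : ⋀[ℝ]^2 (GroupLieAlgebra 𝓘(ℝ, F) G)) :
    contractBivector (c m) v (generatedBivector E F G m p) =
      formAt (contractionForm c p) m ![(v : E)] := by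
  have h : contractBivector (c m) v ∘ₗ generatedBivector E F G m = contractionFormEval c m v := by
    apply exteriorPower.linearMap_ext
    ext X
    simp only [LinearMap.compAlternatingMap_apply, LinearMap.comp_apply, generatedBivector,
      exteriorPower.map_apply_ιMulti, contractionFormEval, contractBivector_ιMulti]
    exact (contractBivector_ιMulti (V := E) (formAt c m) v (fundamentalVector E F G m ∘ X)).symm
  exact LinearMap.congr_fun h p

end

variable [ContMDiffSMul 𝓘(ℝ, F) 𝓘(ℝ, E) ∞ G M] [LieGroup 𝓘(ℝ, F) ∞ G]

/-- The fields generated by Lie algebra elements are equivariant. -/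
theorem fundamentalVector_smul (a : G) (m : M) (X : GroupLieAlgebra 𝓘(ℝ, F) G) :
    fundamentalVector E F G (a • m) X =
      modelDeriv E E (fun z : M => a • z) m (fundamentalVector E F G m (Ad F a⁻¹ X)) := by
  have hAd : toModel (Ad F a⁻¹ X) =
      modelDeriv F F (fun h : G => a⁻¹ * h * a⁻¹⁻¹) 1 (toModel X) := rfl
  have h1 : (fun g : G => g • a • m) = fun g : G => a • ((a⁻¹ * g * a⁻¹⁻¹) • m) := by
    funext g; simp [smul_smul, mul_assoc]
  have hd := mdifferentiableAt_smul_const (E := E) (F := F) (1 : G) m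
  rw [fundamentalVector_apply, fundamentalVector_apply, hAd, h1,
    modelDeriv_comp (f := fun g : G => (a⁻¹ * g * a⁻¹⁻¹) • m) (g := fun z : M => a • z) (y := m)
      (by simp) (mdifferentiableAt_const_smul F a m) (MDifferentiableAt.comp_of_eq (x := 1)
        (f := fun g : G => a⁻¹ * g * a⁻¹⁻¹) (g := fun g : G => g • m) (I' := 𝓘(ℝ, F))
        hd (mdifferentiableAt_conj a⁻¹ 1) (by simp)),
    modelDeriv_comp (f := fun g : G => a⁻¹ * g * a⁻¹⁻¹) (g := fun g : G => g • m) (y := 1)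
      (by simp) hd (mdifferentiableAt_conj a⁻¹ 1)]

variable [FiniteDimensional ℝ E]

/-- Pulling back `p ⌟ c` along the action of `a` gives `(Ad_{a⁻¹} p) ⌟ c`. -/
theorem contractionForm_smul_apply {c : FormField E M 3} (hGc : IsInvariantForm G c) (a : G)
    (m : M) (v : E) (p : ⋀[ℝ]^2 (GroupLieAlgebra 𝓘(ℝ, F) G)) :
    formAt (contractionForm c p) (a • m) ![modelDeriv E E (fun z : M => a • z) m v] =
      formAt (contractionForm c (exteriorPower.map 2 (Ad F a⁻¹) p)) m ![v] := by
  have h1 : fundamentalVector E F G (a • m) =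
      (modelDeriv E E (fun z : M => a • z) m).toLinearMap ∘ₗ
        fundamentalVector E F G m ∘ₗ Ad F a⁻¹ :=
    LinearMap.ext fun X => fundamentalVector_smul a m X
  have h2 : (formAt c (a • m)).compContinuousLinearMap (modelDeriv E E (fun z : M => a • z) m) =
      formAt c m := ContinuousAlternatingMap.ext fun v => hGc.apply a m v
  rw [contractionForm_apply, contractionForm_apply, h1, exteriorPower.map_comp,
    exteriorPower.map_comp]
  simp only [LinearMap.comp_apply]
  rw [← h2, ← contractBivector_map]
  rfl

variable [IsManifold 𝓘(ℝ, E) ∞ M] [FiniteDimensional ℝ F]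

theorem contractionForm_mem_closedForms {c : FormField E M 3} (hc : c ∈ closedForms E M 3)
    (hGc : IsInvariantForm G c) (p : lieKernel (GroupLieAlgebra 𝓘(ℝ, F) G)) :
    contractionForm c (p : ⋀[ℝ]^2 (GroupLieAlgebra 𝓘(ℝ, F) G)) ∈ closedForms E M 1 := by
  obtain ⟨h1, h2⟩ := contractionForm_smooth_and_mextDeriv hc hGc
    (p : ⋀[ℝ]^2 (GroupLieAlgebra 𝓘(ℝ, F) G))
  refine ⟨h1, ?_⟩
  funext x
  refine ContinuousAlternatingMap.ext fun (v : Fin 2 → E) => ?_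
  have hv : v = ![v 0, v 1] := by ext i; fin_cases i <;> rfl
  have h3 := h2 x (v 0) (v 1)
  rw [← hv, show bracketMap _ (p : ⋀[ℝ]^2 (GroupLieAlgebra 𝓘(ℝ, F) G)) = 0 from p.2, map_zero,
    ← zero_smul ℝ (0 : E), threeForm_smul₁, zero_mul, neg_zero] at h3
  exact h3

/-- If `b₁(M) = 0`, there is a smooth map with the differentials required of a multi-moment map. -/
theorem exists_primitive {c : FormField E M 3} (hc : c ∈ closedForms E M 3)
    (hGc : IsInvariantForm G c) (hb : firstBetti E M = 0) :
    ∃ ν : M → Module.Dual ℝ (lieKernel (GroupLieAlgebra 𝓘(ℝ, F) G)),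
      (∀ p, ContMDiff 𝓘(ℝ, E) 𝓘(ℝ, ℝ) ∞ (fun m => ν m p)) ∧
      ∀ (p : lieKernel (GroupLieAlgebra 𝓘(ℝ, F) G)) (m : M) (v : E),
        modelDeriv E ℝ (fun m => ν m p) m v =
          formAt (contractionForm c (p : ⋀[ℝ]^2 (GroupLieAlgebra 𝓘(ℝ, F) G))) m ![v] := by
  have hfin : Module.Finite ℝ (GroupLieAlgebra 𝓘(ℝ, F) G) :=
    inferInstanceAs (Module.Finite ℝ F)
  have hfin' : Module.Finite ℝ (lieKernel (GroupLieAlgebra 𝓘(ℝ, F) G)) := inferInstance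
  let b := Module.Basis.ofVectorSpace ℝ (lieKernel (GroupLieAlgebra 𝓘(ℝ, F) G))
  choose f hf hf' using fun i => exists_eq_differential hb
    (contractionForm_mem_closedForms (F := F) hc hGc (b i))
  have hνp : ∀ (m : M) p, b.constr ℝ (fun i => f i m) p = ∑ i, b.repr p i • f i m := by
    intro m p
    rw [Module.Basis.constr_apply_fintype]
    rfl
  refine ⟨fun m => b.constr ℝ (fun i => f i m), fun p => ?_, fun p m v => ?_⟩
  · simp only [hνp]
    exact contMDiff_finsetSum fun i _ => contMDiff_const.mul (hf i)
  · simp only [hνp]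
    have h := linearMap_apply_eq_sum_repr (V := ⋀[ℝ]^2 (GroupLieAlgebra 𝓘(ℝ, F) G))
      (S := lieKernel (GroupLieAlgebra 𝓘(ℝ, F) G)) b (contractionFormEval c m v) p
    have hf₁ : ∀ i, MDifferentiable 𝓘(ℝ, E) 𝓘(ℝ, ℝ) (f i) := fun i =>
      (hf i).mdifferentiable (by simp)
    refine Eq.trans ?_ (h.symm.trans (contractionFormEval_apply c m v _))
    refine (modelDeriv_sum_smul Finset.univ (fun i => b.repr p i) hf₁ m v).trans ?_
    refine Finset.sum_congr rfl fun i _ => ?_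
    exact congrArg (fun α : FormField E M 1 => b.repr p i • formAt α m ![v]) (hf' i).symm

/-- The defect of equivariance of a primitive is constant on connected components. -/
theorem equivariance_defect_const {c : FormField E M 3}
    (hGc : IsInvariantForm G c) {ν : M → Module.Dual ℝ (lieKernel (GroupLieAlgebra 𝓘(ℝ, F) G))}
    (hν : ∀ p, ContMDiff 𝓘(ℝ, E) 𝓘(ℝ, ℝ) ∞ (fun m => ν m p))
    (hν' : ∀ (p : lieKernel (GroupLieAlgebra 𝓘(ℝ, F) G)) (m : M) (v : E),
        modelDeriv E ℝ (fun m => ν m p) m v =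
          formAt (contractionForm c (p : ⋀[ℝ]^2 (GroupLieAlgebra 𝓘(ℝ, F) G))) m ![v])
    (a : G) {x y : M} (hxy : x ∈ connectedComponent y) :
    ν (a • x) - coAdLieKernel F a (ν x) = ν (a • y) - coAdLieKernel F a (ν y) := by
  ext p
  have hd1 : MDifferentiable 𝓘(ℝ, E) 𝓘(ℝ, ℝ) (fun m => ν (a • m) p) :=
    ((hν p).comp (contMDiff_const_smul_of_contMDiffSMul F a)).mdifferentiable (by simp)
  have hd2 : MDifferentiable 𝓘(ℝ, E) 𝓘(ℝ, ℝ) (fun m => ν m (AdLieKernel F a⁻¹ p)) :=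
    (hν _).mdifferentiable (by simp)
  refine eq_of_modelDeriv_eq_zero (f := fun m => ν (a • m) p - ν m (AdLieKernel F a⁻¹ p))
    (hd1.sub hd2) (fun m => ?_) hxy
  ext v
  have h1 : modelDeriv E ℝ (fun m => ν (a • m) p - ν m (AdLieKernel F a⁻¹ p)) m =
      modelDeriv E ℝ (fun m => ν (a • m) p) m -
        modelDeriv E ℝ (fun m => ν m (AdLieKernel F a⁻¹ p)) m := mfderiv_sub (hd1 m) (hd2 m)
  rw [h1, sub_apply, hν', modelDeriv_comp (f := fun m : M => a • m)
    (g := fun m => ν m p) rfl ((hν p).mdifferentiableAt (by simp))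
    (mdifferentiableAt_const_smul F a m), hν', contractionForm_smul_apply hGc]
  exact sub_self _

end Primitive

/-! ### The centroid of a compact set -/

section Centroid

open MeasureTheory Set
open scoped NNReal

variable {V : Type*} [NormedAddCommGroup V] [NormedSpace ℝ V] [FiniteDimensional ℝ V]

theorem isClosedEmbedding_submodule_add (W : Submodule ℝ V) (p : V) :
    IsClosedEmbedding fun w : W => (w : V) + p :=
  (Homeomorph.addRight p).isClosedEmbedding.comp
    (Submodule.closed_of_finiteDimensional W).isClosedEmbedding_subtypeVal

variable [MeasurableSpace V] [BorelSpace V]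

/-- A Haar measure on the affine subspace `p + W`, as a measure on the ambient space `V`. -/
def affineHaar (W : Submodule ℝ V) (p : V) : Measure V :=
  Measure.map (fun w : W => (w : V) + p) Measure.addHaar

/-- Affine automorphisms preserve Haar measures of affine subspaces up to scaling. -/
theorem exists_affineHaar_eq_smul_map (T : V ≃ᵃ[ℝ] V) {W W' : Submodule ℝ V} {p q : V}
    (hW : W' = W.map (T.linear : V →ₗ[ℝ] V)) (hq : q - T p ∈ W') :
    ∃ c : ℝ≥0, c ≠ 0 ∧ affineHaar W' q = c • (affineHaar W p).map T := by
  subst hW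
  let e : W ≃L[ℝ] W.map (T.linear : V →ₗ[ℝ] V) :=
    (T.linear.submoduleMap W).toContinuousLinearEquiv
  have hT : Measurable T := T.toAffineMap.continuous_of_finiteDimensional.measurable
  have he : Measurable e := e.continuous.measurable
  have hm : ∀ (W : Submodule ℝ V) (p : V), Measurable fun w : W => (w : V) + p := fun W p =>
    (isClosedEmbedding_submodule_add W p).continuous.measurable
  obtain ⟨c, hc⟩ : ∃ c : ℝ≥0, c ≠ 0 ∧
      (Measure.addHaar : Measure (W.map (T.linear : V →ₗ[ℝ] V))) =
        c • (Measure.addHaar : Measure W).map e :=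
    ⟨_, (Measure.addHaarScalarFactor_pos_of_isAddHaarMeasure _ _).ne',
      Measure.isAddLeftInvariant_eq_smul _ _⟩
  refine ⟨c, hc.1, ?_⟩
  have h1 : (affineHaar W p).map T =
      ((Measure.addHaar : Measure W).map e).map
        fun w : W.map (T.linear : V →ₗ[ℝ] V) => (w : V) + T p := by
    rw [affineHaar, Measure.map_map hT (hm _ _), Measure.map_map (hm _ _) he]
    congr 1
    funext w
    exact T.map_vadd p (w : V)
  have h2 : affineHaar (W.map (T.linear : V →ₗ[ℝ] V)) q =
      affineHaar (W.map (T.linear : V →ₗ[ℝ] V)) (T p) := by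
    have h3 : (fun w : W.map (T.linear : V →ₗ[ℝ] V) => (w : V) + q) =
        (fun w : W.map (T.linear : V →ₗ[ℝ] V) => (w : V) + T p) ∘ fun w => w + ⟨_, hq⟩ := by
      funext w; simp [add_assoc]
    rw [affineHaar, h3, ← Measure.map_map (hm _ _) (measurable_add_const _),
      map_add_right_eq_self, affineHaar]
  rw [h2, h1, affineHaar]
  nth_rewrite 1 [hc.2]
  rw [Measure.map_smul]

/-- The closed convex hull of a set has positive measure in its affine span. -/
theorem affineHaar_closure_convexHull_ne_zero {S : Set V} {p : V} (hp : p ∈ S) :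
    affineHaar (vectorSpan ℝ S) p (closure (convexHull ℝ S)) ≠ 0 := by
  set W := vectorSpan ℝ S
  have hemb := isClosedEmbedding_submodule_add W p
  rw [affineHaar, hemb.measurableEmbedding.map_apply]
  let f : W →ᵃ[ℝ] V := W.subtype.toAffineMap + AffineMap.const ℝ W p
  have hconv : Convex ℝ ((fun w : W => (w : V) + p) ⁻¹' closure (convexHull ℝ S)) :=
    (convex_convexHull ℝ S).closure.affine_preimage f
  set S₀ : Set W := (fun w : W => (w : V) + p) ⁻¹' S with hS₀
  have h0 : (0 : W) ∈ S₀ := by simpa [hS₀] using hp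
  have hspan : affineSpan ℝ S₀ = ⊤ := by
    rw [AffineSubspace.affineSpan_eq_top_iff_vectorSpan_eq_top_of_nonempty ℝ W W ⟨0, h0⟩,
      vectorSpan_eq_span_vsub_set_right ℝ h0]
    apply Submodule.map_injective_of_injective W.injective_subtype
    rw [Submodule.map_span, Submodule.map_subtype_top]
    refine Eq.trans ?_ (vectorSpan_eq_span_vsub_set_right ℝ hp).symm
    congr 1
    ext v
    constructor
    · rintro ⟨_, ⟨w, hw, rfl⟩, rfl⟩
      exact ⟨_, hw, by simp⟩
    · rintro ⟨s, hs, rfl⟩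
      exact ⟨⟨s - p, vsub_mem_vectorSpan ℝ hs hp⟩, ⟨_, by simpa [hS₀] using hs, sub_zero _⟩, rfl⟩
  refine (Measure.measure_pos_of_nonempty_interior _ ?_).ne'
  rw [hconv.interior_nonempty_iff_affineSpan_eq_top, eq_top_iff, ← hspan]
  exact affineSpan_mono ℝ (preimage_mono ((subset_convexHull ℝ S).trans subset_closure))

theorem affineHaar_ne_top (W : Submodule ℝ V) (p : V) {K : Set V} (hK : IsCompact K) :
    affineHaar W p K ≠ ⊤ := by
  have hemb := isClosedEmbedding_submodule_add W p
  rw [affineHaar, hemb.measurableEmbedding.map_apply]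
  exact (hemb.isCompact_preimage hK).measure_lt_top.ne

/-- The average position in a compact set is mapped by an affine automorphism to the average
position in the image. -/
theorem setAverage_map_affineEquiv (T : V ≃ᵃ[ℝ] V) (μ : Measure V) {K : Set V} (hK : IsCompact K)
    (h0 : μ K ≠ 0) (htop : μ K ≠ ⊤) : ⨍ x in T '' K, x ∂μ.map T = T (⨍ x in K, x ∂μ) := by
  let A : V →L[ℝ] V := LinearMap.toContinuousLinearMap (T.linear : V →ₗ[ℝ] V)
  have hTA : ∀ x, T x = A x + T 0 := fun x => by simpa [A] using T.map_vadd (0 : V) x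
  have hTc : IsClosedEmbedding T :=
    (AffineEquiv.toContinuousAffineEquiv T).toHomeomorph.isClosedEmbedding
  have hfin : IsFiniteMeasure (μ.restrict K) := ⟨by simpa using htop.lt_top⟩
  have hint : IntegrableOn (fun x : V => x) K μ :=
    continuousOn_id.integrableOn_of_subset_isCompact hK hK.measurableSet subset_rfl htop
  have hreal : μ.real K ≠ 0 := (measureReal_ne_zero_iff htop).2 h0
  rw [setAverage_eq, setAverage_eq, hTc.measurableEmbedding.setIntegral_map, measureReal_def,
    hTc.measurableEmbedding.map_apply, preimage_image_eq _ hTc.injective, ← measureReal_def]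
  rw [integral_congr_ae (Filter.Eventually.of_forall hTA), hTA (_ • _),
    integral_add (A.integrable_comp hint) (integrable_const _), A.integral_comp_comm hint,
    setIntegral_const, smul_add, smul_smul, inv_mul_cancel₀ hreal, one_smul, map_smul]

/-- The centroid of a set `S`: the centre of mass of its closed convex hull for a Haar measure on the
affine span of `S`. The base point and the normalization of that measure do not matter. The
centroid of the empty set is set to `0`. -/
def centroid (S : Set V) : V := by
  classical
  exact if h : S.Nonempty then
    ⨍ x in closure (convexHull ℝ S), x ∂affineHaar (vectorSpan ℝ S) h.some else 0

/-- The centroid commutes with affine automorphisms. -/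
theorem centroid_image (T : V ≃ᵃ[ℝ] V) {S : Set V} (hS : IsCompact S) (hne : S.Nonempty) :
    centroid (T '' S) = T (centroid S) := by
  have hne' : (T '' S).Nonempty := hne.image T
  rw [centroid, centroid, dif_pos hne, dif_pos hne']
  have hK : IsCompact (closure (convexHull ℝ S)) :=
    Metric.isCompact_of_isClosed_isBounded isClosed_closure
      (isBounded_convexHull.2 hS.isBounded).closure
  have himage : closure (convexHull ℝ (T '' S)) = T '' closure (convexHull ℝ S) := by
    have h1 := T.toAffineMap.image_convexHull S
    have h2 := (AffineEquiv.toContinuousAffineEquiv T).toHomeomorph.image_closure (convexHull ℝ S)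
    exact (congrArg closure h1.symm).trans h2.symm
  have hW : vectorSpan ℝ (T '' S) = (vectorSpan ℝ S).map (T.linear : V →ₗ[ℝ] V) :=
    (T.toAffineMap.map_vectorSpan).symm
  -- The scaling factor `c` of the Haar measures cancels in the averages.
  obtain ⟨c, hc, hμ⟩ := exists_affineHaar_eq_smul_map T (p := hne.some) (q := hne'.some) hW
    (vsub_mem_vectorSpan ℝ hne'.some_mem (mem_image_of_mem T hne.some_mem))
  rw [hμ, himage, ← setAverage_map_affineEquiv T _ hK
    (affineHaar_closure_convexHull_ne_zero hne.some_mem) (affineHaar_ne_top _ _ hK),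
    setAverage_eq, setAverage_eq, Measure.restrict_smul, integral_smul_nnreal_measure,
    measureReal_nnreal_smul_apply]
  rw [NNReal.smul_def, smul_smul, mul_inv, mul_assoc, mul_comm _ (c : ℝ), ← mul_assoc,
    inv_mul_cancel₀ (by exact_mod_cast hc), one_mul]

end Centroid

/-! ### Equivariant choices of compact sets in connected components -/

section CompactSets

variable {M : Type*} [TopologicalSpace M] {G : Type*} [Group G] [MulAction G M]

theorem image_smul_connectedComponent (hG : ∀ a : G, Continuous fun m : M => a • m) (a : G)
    (m : M) : (fun x : M => a • x) '' connectedComponent m = connectedComponent (a • m) := by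
  refine ((hG a).image_connectedComponent_subset m).antisymm fun y hy => ⟨a⁻¹ • y, ?_, by simp⟩
  have h := (hG a⁻¹).image_connectedComponent_subset (a • m) ⟨y, hy, rfl⟩
  simpa using h

theorem connectedComponent_smul_congr (hG : ∀ a : G, Continuous fun m : M => a • m) (a : G)
    {x y : M} (h : connectedComponent x = connectedComponent y) :
    connectedComponent (a • x) = connectedComponent (a • y) := by
  rw [← image_smul_connectedComponent hG, h, image_smul_connectedComponent hG]

/-- Two points are related if some translate of one lies in the connected component of the
other. -/
def translateSetoid (hG : ∀ a : G, Continuous fun m : M => a • m) : Setoid M where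
  r x y := ∃ a : G, connectedComponent (a • y) = connectedComponent x
  iseqv :=
    { refl := fun x => ⟨1, by rw [one_smul]⟩
      symm := by
        rintro x y ⟨a, h⟩
        refine ⟨a⁻¹, ?_⟩
        rw [← connectedComponent_smul_congr hG a⁻¹ h, inv_smul_smul]
      trans := by
        rintro x y z ⟨a, h⟩ ⟨b, h'⟩
        exact ⟨a * b, by rw [mul_smul, connectedComponent_smul_congr hG a h', h]⟩ }

/-- If `M` or `G` is compact, every connected component contains a nonempty compact subset, chosen
equivariantly under `G`. -/
theorem exists_equivariant_compact [TopologicalSpace G]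
    (hG : ∀ a : G, Continuous fun m : M => a • m) (hG' : ∀ m : M, Continuous fun a : G => a • m)
    (h : CompactSpace G ∨ CompactSpace M) :
    ∃ K : M → Set M, (∀ m, IsCompact (K m)) ∧ (∀ m, (K m).Nonempty) ∧
      (∀ m, K m ⊆ connectedComponent m) ∧ (∀ m, ∀ x ∈ connectedComponent m, K x = K m) ∧
      ∀ (a : G) (m : M), K (a • m) = (fun x => a • x) '' K m := by
  rcases h with h | h
  · -- In a component, take its intersection with the orbit of a point that is chosen once for
    -- all translates of the component.
    let := translateSetoid hG
    let s : M → M := fun m => (⟦m⟧ : Quotient (translateSetoid hG)).out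
    have hs : ∀ m, ∃ a : G, connectedComponent (a • s m) = connectedComponent m := fun m =>
      Setoid.symm (Quotient.mk_out (s := translateSetoid hG) m)
    have hs' : ∀ x y : M, (∃ a : G, connectedComponent (a • y) = connectedComponent x) →
        s x = s y := fun x y hxy =>
      congrArg Quotient.out (Quotient.sound (s := translateSetoid hG) hxy)
    refine ⟨fun m => Set.range (fun a : G => a • s m) ∩ connectedComponent m,
      fun m => (isCompact_range (hG' _)).inter_right isClosed_connectedComponent, fun m => ?_,
      fun m => Set.inter_subset_right, fun m x hx => ?_, fun a m => ?_⟩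
    · obtain ⟨a, ha⟩ := hs m
      exact ⟨a • s m, ⟨a, rfl⟩, ha ▸ mem_connectedComponent⟩
    · have hx' := connectedComponent_eq hx
      have h1 : s x = s m := hs' _ _ ⟨1, by rw [one_smul, hx']⟩
      simp only [h1, hx']
    · have h1 : s (a • m) = s m := hs' _ _ ⟨a, rfl⟩
      simp only [h1]
      rw [Set.image_inter (MulAction.injective a), image_smul_connectedComponent hG]
      congr 1
      ext y
      constructor
      · rintro ⟨b, rfl⟩
        exact ⟨_, ⟨a⁻¹ * b, rfl⟩, by simp [smul_smul]⟩
      · rintro ⟨_, ⟨b, rfl⟩, rfl⟩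
        exact ⟨a * b, by simp [smul_smul]⟩
  · exact ⟨connectedComponent, fun m => isClosed_connectedComponent.isCompact,
      fun m => connectedComponent_nonempty, fun m => subset_rfl,
      fun m x hx => (connectedComponent_eq hx).symm,
      fun a m => (image_smul_connectedComponent hG a m).symm⟩

end CompactSets

/-! ### Correction of a primitive -/

section Correction

/-- Let `ν` be a map into the dual of `S` that is equivariant, for the transposes of the injective
endomorphisms `B a`, up to constants on connected components. Then `ν` becomes equivariant after
subtracting a map that is constant on connected components: the centroid of the values of `ν`
on an equivariantly chosen compact subset of the component. -/
theorem exists_equivariant_correction {M : Type*} [TopologicalSpace M] {G : Type*} [Group G]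
    [TopologicalSpace G] [MulAction G M]
    (hG : ∀ a : G, Continuous fun m : M => a • m) (hG' : ∀ m : M, Continuous fun a : G => a • m)
    (h : CompactSpace G ∨ CompactSpace M)
    {S : Type*} [AddCommGroup S] [Module ℝ S] [FiniteDimensional ℝ S]
    {B : G → S →ₗ[ℝ] S} (hB : ∀ a, Function.Injective (B a))
    {ν : M → Module.Dual ℝ S} (hν : ∀ p, Continuous fun m => ν m p)
    (hconst : ∀ (a : G) (x y : M), x ∈ connectedComponent y →
      ν (a • x) - ν x ∘ₗ B a = ν (a • y) - ν y ∘ₗ B a) :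
    ∃ ζ : M → Module.Dual ℝ S, (∀ x y, x ∈ connectedComponent y → ζ x = ζ y) ∧
      ∀ (a : G) (m : M), ν (a • m) - ζ (a • m) = (ν m - ζ m) ∘ₗ B a := by
  let b := Module.Basis.ofVectorSpace ℝ S
  let e := (b.constr ℝ (M' := ℝ)).symm
  obtain ⟨K, hKc, hKne, hKsub, hKconst, hKsmul⟩ := exists_equivariant_compact hG hG' h
  let N := fun m => e (ν m)
  have hN : Continuous N := continuous_pi fun i => hν (b i)
  refine ⟨fun m => e.symm (centroid (N '' K m)), fun x y hxy => ?_, fun a m => ?_⟩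
  · simp only [hKconst y x hxy]
  let A := (LinearEquiv.ofInjectiveEndo (B a) (hB a)).dualMap
  have hA : ∀ β, A β = β ∘ₗ B a := fun β => rfl
  set w := ν (a • m) - ν m ∘ₗ B a with hw
  -- On the component of `m`, the action of `a` corresponds under `N` to an affine automorphism.
  let T := ((e.symm.trans A).trans e).toAffineEquiv.trans
    (AffineEquiv.constVAdd ℝ (_ → ℝ) (e w))
  have hT : ∀ v, T v = e w + e (A (e.symm v)) := fun v => rfl
  have himage : N '' K (a • m) = T '' (N '' K m) := by
    rw [hKsmul, Set.image_image, Set.image_image]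
    refine Set.image_congr fun x hx => ?_
    have h1 := hconst a x m (hKsub m hx)
    simp only [N]
    rw [hT, e.symm_apply_apply, ← map_add, hA, hw, ← h1, sub_add_cancel]
  have hcomp := (hKc m).image hN
  simp only [himage]
  rw [centroid_image T hcomp ((hKne m).image N), hT, map_add, e.symm_apply_apply,
    e.symm_apply_apply, hw, ← hA (_ - _), map_sub, hA (ν m)]
  abel

variable {E : Type*} [NormedAddCommGroup E] [NormedSpace ℝ E]
  {M : Type*} [TopologicalSpace M] [ChartedSpace E M]

/-- Subtracting a map that is constant on connected components changes neither smoothness nor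
derivatives. -/
theorem contMDiff_sub_and_modelDeriv_sub [LocallyConnectedSpace M] {S : Type*}
    [AddCommGroup S] [Module ℝ S] {ν ζ : M → Module.Dual ℝ S} {p : S}
    (hν : ContMDiff 𝓘(ℝ, E) 𝓘(ℝ, ℝ) ∞ fun m => ν m p)
    (hζ : ∀ x y, x ∈ connectedComponent y → ζ x = ζ y) :
    ContMDiff 𝓘(ℝ, E) 𝓘(ℝ, ℝ) ∞ (fun m => (ν m - ζ m) p) ∧
      ∀ m, modelDeriv E ℝ (fun m => (ν m - ζ m) p) m = modelDeriv E ℝ (fun m => ν m p) m := by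
  have hloc : ∀ m, (fun x => (ν x - ζ x) p) =ᶠ[𝓝 m] fun x => ν x p - ζ m p := fun m => by
    filter_upwards [isOpen_connectedComponent.mem_nhds (mem_connectedComponent (x := m))] with x hx
    rw [hζ x m hx, LinearMap.sub_apply]
  refine ⟨fun m => ((hν m).sub contMDiffAt_const).congr_of_eventuallyEq (hloc m), fun m => ?_⟩
  have h2 : modelDeriv E ℝ (fun x => (ν x - ζ x) p) m =
      modelDeriv E ℝ (fun x => ν x p - ζ m p) m := (hloc m).mfderiv_eq
  have h3 : modelDeriv E ℝ (fun x => ν x p - ζ m p) m =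
      modelDeriv E ℝ (fun m => ν m p) m - modelDeriv E ℝ (fun _ : M => ζ m p) m :=
    mfderiv_sub (hν.mdifferentiableAt (by simp)) mdifferentiableAt_const
  rw [h2, h3, modelDeriv_const, sub_zero]

/-- A smooth map into the dual of `S` that is equivariant up to constants on connected components
can be made equivariant without changing its derivative. -/
theorem exists_equivariant_modelDeriv_eq [LocallyConnectedSpace M] {G : Type*} [Group G]
    [TopologicalSpace G] [MulAction G M]
    (hG : ∀ a : G, Continuous fun m : M => a • m) (hG' : ∀ m : M, Continuous fun a : G => a • m)
    (h : CompactSpace G ∨ CompactSpace M)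
    {S : Type*} [AddCommGroup S] [Module ℝ S] [FiniteDimensional ℝ S]
    {B : G → S →ₗ[ℝ] S} (hB : ∀ a, Function.Injective (B a))
    {ν : M → Module.Dual ℝ S} (hν : ∀ p, ContMDiff 𝓘(ℝ, E) 𝓘(ℝ, ℝ) ∞ fun m => ν m p)
    (hconst : ∀ (a : G) (x y : M), x ∈ connectedComponent y →
      ν (a • x) - ν x ∘ₗ B a = ν (a • y) - ν y ∘ₗ B a) :
    ∃ ν' : M → Module.Dual ℝ S, (∀ p, ContMDiff 𝓘(ℝ, E) 𝓘(ℝ, ℝ) ∞ fun m => ν' m p) ∧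
      (∀ p m, modelDeriv E ℝ (fun m => ν' m p) m = modelDeriv E ℝ (fun m => ν m p) m) ∧
      ∀ (a : G) (m : M), ν' (a • m) = ν' m ∘ₗ B a := by
  obtain ⟨ζ, hζ, hζ'⟩ := exists_equivariant_correction hG hG' h hB
    (fun p => (hν p).continuous) hconst
  exact ⟨fun m => ν m - ζ m, fun p => (contMDiff_sub_and_modelDeriv_sub (hν p) hζ).1,
    fun p => (contMDiff_sub_and_modelDeriv_sub (hν p) hζ).2, hζ'⟩

end Correction

/-! ### Existence of multi-moment maps -/

section Existence

variable {F : Type*} [NormedAddCommGroup F] [NormedSpace ℝ F]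
  {G : Type*} [TopologicalSpace G] [ChartedSpace F G] [Group G] [LieGroup 𝓘(ℝ, F) ∞ G]

theorem Ad_injective (a : G) : Function.Injective (Ad F a) := by
  have h : (mfderiv 𝓘(ℝ, F) 𝓘(ℝ, F) (fun x : G => a * x * a⁻¹) 1).IsInvertible :=
    isInvertible_mfderiv_conj a 1
  exact h.injective

variable [FiniteDimensional ℝ F]

theorem AdLieKernel_injective (a : G) : Function.Injective (AdLieKernel F a) := by
  intro p q hpq
  have h : Function.Injective (exteriorPower.map 2 (Ad F a)) :=
    exteriorPower.map_injective_field (Ad_injective a)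
  exact Subtype.ext (h (congrArg Subtype.val hpq))

variable {E : Type*} [NormedAddCommGroup E] [NormedSpace ℝ E] [FiniteDimensional ℝ E]
  {M : Type*} [TopologicalSpace M] [ChartedSpace E M] [IsManifold 𝓘(ℝ, E) ∞ M]
  [MulAction G M] [ContMDiffSMul 𝓘(ℝ, F) 𝓘(ℝ, E) ∞ G M]

/-- If `b₁(M) = 0`, and `G` or `M` is compact, there is a multi-moment map. -/
theorem exists_isMultiMomentMap {c : FormField E M 3} (hc : c ∈ closedForms E M 3)
    (hGc : IsInvariantForm G c) (hb : firstBetti E M = 0) (h : CompactSpace G ∨ CompactSpace M) :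
    ∃ ν : M → Module.Dual ℝ (lieKernel (GroupLieAlgebra 𝓘(ℝ, F) G)), IsMultiMomentMap c ν := by
  have hfin : Module.Finite ℝ (GroupLieAlgebra 𝓘(ℝ, F) G) :=
    inferInstanceAs (Module.Finite ℝ F)
  have hfin' : FiniteDimensional ℝ (lieKernel (GroupLieAlgebra 𝓘(ℝ, F) G)) := inferInstance
  obtain ⟨ν, hν, hν'⟩ := exists_primitive (F := F) hc hGc hb
  have hG : ∀ a : G, Continuous fun m : M => a • m := fun a =>
    (contMDiff_const_smul_of_contMDiffSMul (E := E) F a).continuous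
  have hG' : ∀ m : M, Continuous fun a : G => a • m := fun m =>
    have := ContMDiffSMul.continuousSMul (I := 𝓘(ℝ, F)) (I' := 𝓘(ℝ, E)) (n := ∞) (G := G) (M := M)
    continuous_id.smul continuous_const
  have : LocallyConnectedSpace M := ChartedSpace.locallyConnectedSpace E M
  have hinj : ∀ a : G, Function.Injective (AdLieKernel F a⁻¹) := fun a => AdLieKernel_injective a⁻¹
  have hdef : ∀ (a : G) (x y : M), x ∈ connectedComponent y →
      ν (a • x) - ν x ∘ₗ AdLieKernel F a⁻¹ = ν (a • y) - ν y ∘ₗ AdLieKernel F a⁻¹ :=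
    fun a x y hxy => equivariance_defect_const hGc hν hν' a hxy
  obtain ⟨ν', h1, h2, h3⟩ := exists_equivariant_modelDeriv_eq
    (S := lieKernel (GroupLieAlgebra 𝓘(ℝ, F) G))
    (B := fun a => AdLieKernel F a⁻¹) (ν := ν) hG hG' h hinj hν hdef
  exact ⟨ν', h1, fun p m v => (DFunLike.congr_fun (h2 p m) (v : E)).trans
    ((hν' p m v).trans (contractBivector_generatedBivector c m v _).symm), h3⟩

end Existence

end MultiMoment

end

theorem mainTheorem1
    -- a smooth manifold `M` without boundary
    {E : Type*} [NormedAddCommGroup E] [NormedSpace ℝ E] [FiniteDimensional ℝ E]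
    {M : Type*} [TopologicalSpace M] [T2Space M] [SecondCountableTopology M]
    [ChartedSpace E M] [IsManifold 𝓘(ℝ, E) ∞ M]
    -- a Lie group `G` acting smoothly on `M`
    {F : Type*} [NormedAddCommGroup F] [NormedSpace ℝ F] [FiniteDimensional ℝ F]
    {G : Type*} [TopologicalSpace G] [T2Space G] [ChartedSpace F G] [Group G]
    [LieGroup 𝓘(ℝ, F) ∞ G] [MulAction G M] [ContMDiffSMul 𝓘(ℝ, F) 𝓘(ℝ, E) ∞ G M]
    -- a closed three-form preserved by `G`
    (c : MultiMoment.FormField E M 3) (hc : c ∈ MultiMoment.closedForms E M 3)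
    (hGc : MultiMoment.IsInvariantForm G c)
    (hb : MultiMoment.firstBetti E M = 0)
    (h : CompactSpace G ∨
      (CompactSpace M ∧ ∃ μ : MultiMoment.FormField E M (Module.finrank ℝ E),
        MultiMoment.IsVolumeForm μ ∧ MultiMoment.IsInvariantForm G μ)) :
    ∃ ν : M → Module.Dual ℝ (MultiMoment.lieKernel (GroupLieAlgebra 𝓘(ℝ, F) G)),
      MultiMoment.IsMultiMomentMap c ν :=
  MultiMoment.exists_isMultiMomentMap hc hGc hb (h.imp_right And.left)
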